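/- Let $(k,|\cdot|)$ be a complete non-archimedean valued field and let $g\ge 2$. Let $\mathbb{P}^{1,\mathrm{an}}_k$ be the Berkovich projective line over $k$, on which $\mathrm{PGL}_2(k)$ acts by Möbius transformations. Open (resp. closed) discs are the images under $\mathrm{PGL}_2(k)$ of the sets $D^-(a,r)=\{|Z-a|<r\}$ (resp. $D^+(a,r)=\{|Z-a|\le r\}$) with $a\in k$, $r>0$, where $Z$ is the standard coordinate. Let $\alpha_1,\alpha_1',\dots,\alpha_g,\alpha_g'$ be distinct elements of $\mathbb{P}^1(k)$ and let $A$ be the set they form. Let $\beta_1,\dots,\beta_g\in k$ with $0<|\beta_i|<1$. Let $\gamma_i=M(\alpha_i,\alpha_i',\beta_i)\in\mathrm{PGL}_2(k)$ be the transformation with attracting fixed point $\alpha_i$, repelling fixed point $\alpha_i'$ and multiplier $\beta_i$: for $\alpha=[u:v]$ and $\alpha'=[u':v']$, $$M(\alpha,\alpha',\beta)=\begin{bmatrix} uv'-\beta u'v & (\beta-1)uu'\\ (1-\beta)vv' & \beta uv'-u'v\end{bmatrix}.$$ For $\alpha\in A$, let $D^-(\alpha,A)$ be the biggest open disc that contains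 $\alpha$ and no other element of $A$, and let $p_{\alpha,A}$ be its boundary point. For two points $p,q$, let $[p\,q]$ be the segment joining them in the real tree $\mathbb{P}^{1,\mathrm{an}}_k$. Denote by $\ell$ the multiplicative length of segments: if $I$ is, in some coordinate on $\mathbb{P}^{1,\mathrm{an}}_k$, the image of the segment $[\eta_{a,r},\eta_{a,s}]$ of $\mathbb{P}^{1,\mathrm{an}}_{k'}$, where $k'/k$ is a finite extension, $a\in k'$, $0<r\le s$ and $\eta_{a,t}$ is the point of the Shilov boundary of $D^+(a,t)$, then $\ell(I)=s/r$. For points $a,b,c,d$ of $\mathbb{P}^1(k)$ with $a,b\notin\{c,d\}$, set $[a,b;c,d]=\frac{(a-c)(b-d)}{(a-d)(b-c)}$ (with the usual conventions at $\infty$). A Schottky figure adapted to $(\gamma_1,\dots,\gamma_g)$ is a family of pairwise disjoint closed discs $B^+(\gamma_i^{\varepsilon})\subset\mathbb{P}^{1,\mathrm{an}}_k$ ($1\le i\le g$, $\varepsilon=\pm1$) such that, for all $i$ and $\varepsilon$, the set $\gamma_i^{\varepsilon}\big(\mathbb{P}^{1,\mathrm{an}}_k\setminus B^+(\gamma_i^{-\varepsilon})\big)$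 is a maximal open disc inside $B^+(\gamma_i^{\varepsilon})$. Then the following conditions are equivalent: 1. there exists a Schottky figure adapted to $(\gamma_1,\dots,\gamma_g)$; 2. for each $i\in\{1,\dots,g\}$, $\ell([p_{\alpha_i,A}\,p_{\alpha_i',A}])<|\beta_i|^{-1}$; 3. for all $i,j,l\in\{1,\dots,g\}$ with $j\ne i$ and $l\ne i$, all $a\in\{\alpha_j,\alpha_j'\}$ and all $b\in\{\alpha_l,\alpha_l'\}$, $|\beta_i|\cdot|[a,b;\alpha_i,\alpha_i']|<1$. -/

import Mathlib

/-!
The Berkovich projective line over a normed field `k`, the action of `PGL₂(k)` on it, its discs,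
segments and their lengths, Schottky figures, Koebe coordinates and cross-ratios.

The projective line is described in homogeneous coordinates. Its affine coordinate is
`Z = X₀ / X₁`, so that the point `[u : v]` has coordinate `u / v` and `∞ = [1 : 0]`.
-/

universe u

open scoped Pointwise

noncomputable section

namespace Berkovich

/-- A point of the punctured analytic affine plane over `k`: a multiplicative seminorm on
`k[X₀, X₁]` that extends the absolute value of `k` and does not vanish at both `X₀` and `X₁`. -/
structure ConePoint (k : Type u) [NormedField k] where
  /-- the multiplicative seminorm -/
  seminorm : MulRingSeminorm (MvPolynomial (Fin 2) k)
  map_C : ∀ c : k, seminorm (MvPolynomial.C c) = ‖c‖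
  exists_ne_zero : ∃ i : Fin 2, seminorm (MvPolynomial.X i) ≠ 0

theorem ConePoint.ext {k : Type u} [NormedField k] {y z : ConePoint k}
    (h : ∀ F, y.seminorm F = z.seminorm F) : y = z := by
  cases y
  cases z
  congr 1
  exact MulRingSeminorm.ext h

/-- The topology of pointwise convergence of seminorms. -/
instance (k : Type u) [NormedField k] : TopologicalSpace (ConePoint k) :=
  TopologicalSpace.induced
    (fun y => (fun F => y.seminorm F : MvPolynomial (Fin 2) k → ℝ)) inferInstance

/-- Two points of the punctured plane define the same point of the projective line when, for some
`C > 0`, they differ by the factor `C ^ d` on the homogeneous polynomials of each degree `d`. -/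
def coneSetoid (k : Type u) [NormedField k] : Setoid (ConePoint k) where
  r y z := ∃ C : ℝ, 0 < C ∧ ∀ (d : ℕ) (F : MvPolynomial (Fin 2) k), F.IsHomogeneous d →
    y.seminorm F = C ^ d * z.seminorm F
  iseqv :=
    { refl := fun y => ⟨1, one_pos, fun d F _ => by simp⟩
      symm := by
        rintro y z ⟨C, hC, h⟩
        refine ⟨C⁻¹, inv_pos.2 hC, fun d F hF => ?_⟩
        rw [h d F hF, ← mul_assoc, ← mul_pow, inv_mul_cancel₀ hC.ne', one_pow, one_mul]
      trans := by
        rintro y z w ⟨C, hC, h⟩ ⟨D, hD, h'⟩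
        refine ⟨C * D, mul_pos hC hD, fun d F hF => ?_⟩
        rw [h d F hF, h' d F hF, mul_pow, mul_assoc] }

/-- The analytic projective line `ℙ^{1,an}_k` in the sense of Berkovich. -/
def ProjLine (k : Type u) [NormedField k] : Type u := Quotient (coneSetoid k)

/-- The projection from the punctured plane to the projective line. -/
def ProjLine.mk {k : Type u} [NormedField k] (y : ConePoint k) : ProjLine k :=
  Quotient.mk (coneSetoid k) y

instance (k : Type u) [NormedField k] : TopologicalSpace (ProjLine k) :=
  inferInstanceAs (TopologicalSpace (Quotient (coneSetoid k)))

/-! ### The Möbius action -/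

/-- The linear substitution `F(X) ↦ F(gX)`, that is
`X₀ ↦ g₀₀ X₀ + g₀₁ X₁`, `X₁ ↦ g₁₀ X₀ + g₁₁ X₁`. -/
def subst {k : Type u} [NormedField k] (g : Matrix (Fin 2) (Fin 2) k) :
    MvPolynomial (Fin 2) k →ₐ[k] MvPolynomial (Fin 2) k :=
  MvPolynomial.aeval
    (fun i => ∑ j : Fin 2, MvPolynomial.C (g i j) * (MvPolynomial.X j : MvPolynomial (Fin 2) k))

theorem subst_one {k : Type u} [NormedField k] :
    subst (1 : Matrix (Fin 2) (Fin 2) k) = AlgHom.id k _ := by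
  apply MvPolynomial.algHom_ext
  intro i
  fin_cases i <;> simp [subst, Matrix.one_apply]

theorem subst_mul {k : Type u} [NormedField k] (g h : Matrix (Fin 2) (Fin 2) k) :
    subst (g * h) = (subst h).comp (subst g) := by
  apply MvPolynomial.algHom_ext
  intro i
  simp only [subst, MvPolynomial.aeval_X, AlgHom.comp_apply, map_mul,
    MvPolynomial.algHom_C, Matrix.mul_apply, Fin.sum_univ_two, MvPolynomial.algebraMap_eq, map_add]
  ring

theorem subst_isHomogeneous {k : Type u} [NormedField k] (g : Matrix (Fin 2) (Fin 2) k)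
    {d : ℕ} {F : MvPolynomial (Fin 2) k} (hF : F.IsHomogeneous d) :
    (subst g F).IsHomogeneous d := by
  have := hF.aeval (S := k) (fun i => ∑ j : Fin 2, MvPolynomial.C (g i j) * MvPolynomial.X j)
    (n := 1) (fun i => MvPolynomial.IsHomogeneous.sum _ _ _ (fun j _ =>
      MvPolynomial.isHomogeneous_C_mul_X _ _))
  simpa [subst] using this

/-- A seminorm is transported by `g` as `|F|_{g y} = |F(gX)|_y`; on a `k`-point `(u, v)` this is
the multiplication of the column vector `(u, v)` by the matrix `g`. -/
instance (k : Type u) [NormedField k] : MulAction (GL (Fin 2) k) (ConePoint k) where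
  smul g y :=
    { seminorm :=
        { toFun := fun F => y.seminorm (subst g.1 F)
          map_zero' := by simp
          add_le' := fun F G => by simpa using map_add_le_add y.seminorm _ _
          neg' := fun F => by simp
          map_one' := by simp
          map_mul' := fun F G => by simp }
      map_C := fun c => by
        change y.seminorm (subst g.1 (MvPolynomial.C c)) = ‖c‖
        rw [subst, MvPolynomial.algHom_C]
        exact y.map_C c
      exists_ne_zero := by
        by_contra! hcon
        have hcon' : ∀ i, y.seminorm (subst g.1 (MvPolynomial.X i)) = 0 := hcon
        obtain ⟨i, hi⟩ := y.exists_ne_zero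
        apply hi
        have e : (MvPolynomial.X i : MvPolynomial (Fin 2) k)
            = ∑ j : Fin 2, MvPolynomial.C ((g⁻¹).1 i j) * subst g.1 (MvPolynomial.X j) := by
          have h1 : subst ((g⁻¹).1 * g.1) (MvPolynomial.X i : MvPolynomial (Fin 2) k)
              = MvPolynomial.X i := by
            rw [← Units.val_mul, inv_mul_cancel, Units.val_one, subst_one]; rfl
          rw [subst_mul, AlgHom.comp_apply] at h1
          rw [← h1]
          conv_lhs => rw [subst.eq_def ((g⁻¹).1), MvPolynomial.aeval_X]
          simp [MvPolynomial.algHom_C]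
        rw [e, Fin.sum_univ_two]
        refine le_antisymm ((map_add_le_add y.seminorm _ _).trans ?_) (apply_nonneg _ _)
        rw [map_mul, map_mul, hcon', hcon']
        simp }
  one_smul y := ConePoint.ext fun F => by
    change y.seminorm (subst (1 : Matrix (Fin 2) (Fin 2) k) F) = y.seminorm F
    rw [subst_one]
    rfl
  mul_smul g h y := ConePoint.ext fun F => by
    change y.seminorm (subst (g.1 * h.1) F) = y.seminorm (subst h.1 (subst g.1 F))
    rw [subst_mul]
    rfl

theorem smul_seminorm {k : Type u} [NormedField k] (g : GL (Fin 2) k) (y : ConePoint k)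
    (F : MvPolynomial (Fin 2) k) : (g • y).seminorm F = y.seminorm (subst g.1 F) := rfl

instance (k : Type u) [NormedField k] : MulAction (GL (Fin 2) k) (ProjLine k) where
  smul g := Quotient.map (fun y => g • y) (by
    rintro y z ⟨C, hC, h⟩
    exact ⟨C, hC, fun d F hF => h d _ (subst_isHomogeneous g.1 hF)⟩)
  one_smul x := by
    induction x using Quotient.inductionOn with
    | h y => exact congrArg (Quotient.mk (coneSetoid k)) (one_smul _ y)
  mul_smul g h x := by
    induction x using Quotient.inductionOn with
    | h y => exact congrArg (Quotient.mk (coneSetoid k)) (mul_smul g h y)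

theorem smul_mk {k : Type u} [NormedField k] (g : GL (Fin 2) k) (y : ConePoint k) :
    g • ProjLine.mk y = ProjLine.mk (g • y) := rfl

theorem subst_scalar {k : Type u} [NormedField k] (c : k) {d : ℕ} {F : MvPolynomial (Fin 2) k}
    (hF : F.IsHomogeneous d) :
    subst (Matrix.scalar (Fin 2) c) F = MvPolynomial.C (c ^ d) * F := by
  have h1 : ∀ i : Fin 2, ∑ j : Fin 2, MvPolynomial.C (Matrix.scalar (Fin 2) c i j) *
      (MvPolynomial.X j : MvPolynomial (Fin 2) k) = MvPolynomial.C c * MvPolynomial.X i := by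
    intro i
    fin_cases i <;> simp [Fin.sum_univ_two]
  rw [subst]
  simp only [h1]
  rw [MvPolynomial.aeval_def, MvPolynomial.eval₂_eq]
  conv_rhs => rw [F.as_sum, Finset.mul_sum]
  refine Finset.sum_congr rfl fun m hm => ?_
  have hd : m 0 + m 1 = d := by
    have := hF (MvPolynomial.mem_support_iff.1 hm)
    rwa [Finsupp.weight_apply, Finsupp.sum_fintype _ _ (by simp), Fin.sum_univ_two,
      Pi.one_apply, Pi.one_apply, smul_eq_mul, smul_eq_mul, mul_one, mul_one] at this
  have hm' : (MvPolynomial.monomial m (F.coeff m) : MvPolynomial (Fin 2) k)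
      = MvPolynomial.C (F.coeff m) * (MvPolynomial.X 0 ^ m 0 * MvPolynomial.X 1 ^ m 1) := by
    rw [MvPolynomial.monomial_eq, Finsupp.prod_fintype _ _ (by simp), Fin.prod_univ_two]
  rw [hm', ← hd, Finset.prod_subset (Finset.subset_univ _) (fun i _ hi => by
      rw [Finsupp.notMem_support_iff.1 hi, pow_zero]), Fin.prod_univ_two,
    MvPolynomial.algebraMap_eq, mul_pow, mul_pow, map_pow]
  ring

theorem scalar_smul {k : Type u} [NormedField k] (c : kˣ) (x : ProjLine k) :
    Matrix.GeneralLinearGroup.scalar (Fin 2) c • x = x := by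
  induction x using Quotient.inductionOn with
  | h y =>
    refine Quotient.sound ⟨‖(c : k)‖, norm_pos_iff.2 c.ne_zero, fun d F hF => ?_⟩
    rw [smul_seminorm]
    have : (Matrix.GeneralLinearGroup.scalar (Fin 2) c).1 = Matrix.scalar (Fin 2) (c : k) := by
      simp
    rw [this, subst_scalar _ hF, map_mul, y.map_C, norm_pow]

/-- The action of `PGL₂(k)` on the analytic projective line by Möbius transformations. -/
instance (k : Type u) [NormedField k] :
    MulAction (Matrix.ProjGenLinGroup (Fin 2) k) (ProjLine k) :=
  Matrix.ProjGenLinGroup.mulActionOfGL scalar_smul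

/-! ### Rational points -/

/-- The point of the punctured plane defined by a non-zero vector: `F ↦ |F(w)|`. -/
def ConePoint.ofVec {k : Type u} [NormedField k] (w : Fin 2 → k) (hw : w ≠ 0) : ConePoint k where
  seminorm :=
    { toFun := fun F => ‖MvPolynomial.eval w F‖
      map_zero' := by simp
      add_le' := fun F G => by simpa using norm_add_le _ _
      neg' := fun F => by simp
      map_one' := by simp
      map_mul' := fun F G => by simp }
  map_C := fun c => by
    change ‖MvPolynomial.eval w (MvPolynomial.C c)‖ = ‖c‖
    simp
  exists_ne_zero := by
    obtain ⟨i, hi⟩ := Function.ne_iff.1 hw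
    refine ⟨i, ?_⟩
    change ‖MvPolynomial.eval w (MvPolynomial.X i)‖ ≠ 0
    simpa using hi

/-- The point of `ℙ^{1,an}_k` defined by a point of `ℙ¹(k)`. -/
def ratPoint {k : Type u} [NormedField k] (p : Projectivization k (Fin 2 → k)) : ProjLine k :=
  ProjLine.mk (ConePoint.ofVec p.rep p.rep_nonzero)

/-! ### Discs -/

/-- The closed disc `D⁺(a, r) = {|Z - a| ≤ r}`. -/
def closedDisc {k : Type u} [NormedField k] (a : k) (r : ℝ) : Set (ProjLine k) :=
  ProjLine.mk '' {y | y.seminorm (MvPolynomial.X 0 - MvPolynomial.C a * MvPolynomial.X 1) ≤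
    r * y.seminorm (MvPolynomial.X 1)}

/-- The open disc `D⁻(a, r) = {|Z - a| < r}`. -/
def openDisc {k : Type u} [NormedField k] (a : k) (r : ℝ) : Set (ProjLine k) :=
  ProjLine.mk '' {y | y.seminorm (MvPolynomial.X 0 - MvPolynomial.C a * MvPolynomial.X 1) <
    r * y.seminorm (MvPolynomial.X 1)}

/-- A closed disc of the projective line: some `D⁺(a, r)`, `r > 0`, in some coordinate. -/
def IsClosedDisc {k : Type u} [NormedField k] (D : Set (ProjLine k)) : Prop :=
  ∃ (g : Matrix.ProjGenLinGroup (Fin 2) k) (a : k) (r : ℝ), 0 < r ∧ D = g • closedDisc a r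

/-- An open disc of the projective line: some `D⁻(a, r)`, `r > 0`, in some coordinate. -/
def IsOpenDisc {k : Type u} [NormedField k] (D : Set (ProjLine k)) : Prop :=
  ∃ (g : Matrix.ProjGenLinGroup (Fin 2) k) (a : k) (r : ℝ), 0 < r ∧ D = g • openDisc a r

/-- `D` is the biggest open disc that contains `α` and no other element of `A`: the disc
`D⁻(α, A)`. (In the non-archimedean setting, any point of `ℙ¹(k)` in a disc is a center of it.) -/
def IsBiggestDisc {k : Type u} [NormedField k] (α : Projectivization k (Fin 2 → k))
    (A : Set (Projectivization k (Fin 2 → k))) (D : Set (ProjLine k)) : Prop :=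
  IsGreatest {E : Set (ProjLine k) | IsOpenDisc E ∧ ratPoint α ∈ E ∧
    ∀ b ∈ A, b ≠ α → ratPoint b ∉ E} D

/-- `p` is the boundary point `p_{α,A}` of the disc `D⁻(α, A)`. -/
def IsDiscBoundaryPoint {k : Type u} [NormedField k] (α : Projectivization k (Fin 2 → k))
    (A : Set (Projectivization k (Fin 2 → k))) (p : ProjLine k) : Prop :=
  ∃ D : Set (ProjLine k), IsBiggestDisc α A D ∧ frontier D = {p}

/-! ### Segments and lengths -/

/-- The segment `[x y]`. In the real tree `ℙ^{1,an}_k` the image of every path from `x` to `y`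
contains the unique arc joining `x` to `y` (reduced to a point if `x = y`), and this arc is itself
the image of a path, so the intersection is that arc. -/
def segment {k : Type u} [NormedField k] (x y : ProjLine k) : Set (ProjLine k) :=
  ⋂ φ : Path x y, Set.range φ

/-- For an element `a` of a normed extension `k'` of `k` and `t > 0`, the point `x` is the image in
`ℙ^{1,an}_k` of the point `η_{a,t}` of `ℙ^{1,an}_{k'}`, the Shilov boundary of the disc
`D⁺(a, t)`, i.e. `|∑ cᵢ (Z - a)ⁱ| = max |cᵢ| tⁱ`. -/
def IsEta {k k' : Type u} [NormedField k] [NormedField k'] [NormedAlgebra k k']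
    (a : k') (t : ℝ) (x : ProjLine k) : Prop :=
  ∃ y : ConePoint k, ProjLine.mk y = x ∧ ∀ F : MvPolynomial (Fin 2) k,
    y.seminorm F = (MvPolynomial.aeval
      ![(Polynomial.X + Polynomial.C a : Polynomial k'), 1] F).gaussNorm
        (NormedField.toAbsoluteValue k') t

/-- `L` is the multiplicative length of `I`: there are a finite extension `k'` of `k`, a coordinate
on the projective line, `a ∈ k'` and `0 < r ≤ s` such that `I` is the image of the segment
`[η_{a,r}, η_{a,s}] = {η_{a,t} : r ≤ t ≤ s}`, and `L = s / r`. -/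
def HasLength {k : Type u} [NormedField k] (I : Set (ProjLine k)) (L : ℝ) : Prop :=
  ∃ (k' : Type u) (_ : NormedField k') (_ : NormedAlgebra k k') (_ : FiniteDimensional k k')
    (g : Matrix.ProjGenLinGroup (Fin 2) k) (a : k') (r s : ℝ), 0 < r ∧ r ≤ s ∧
    I = g • {x : ProjLine k | ∃ t ∈ Set.Icc r s, IsEta a t x} ∧ L = s / r

/-! ### Schottky figures -/

/-- The sets `B⁻(γᵢ^ε) = γᵢ^ε (ℙ¹ ∖ B⁺(γᵢ^{-ε}))`. -/
def innerDisc {k : Type u} [NormedField k] {g : ℕ}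
    (γ : Fin g → Matrix.ProjGenLinGroup (Fin 2) k) (B : Fin g → ℤˣ → Set (ProjLine k))
    (i : Fin g) (ε : ℤˣ) : Set (ProjLine k) :=
  (γ i) ^ (ε : ℤ) • (B i (-ε))ᶜ

/-- The family `B i ε = B⁺(γᵢ^ε)`, `ε = ±1`, is a Schottky figure adapted to `(γ₁, …, γ_g)`. -/
structure IsSchottkyFigure {k : Type u} [NormedField k] {g : ℕ}
    (γ : Fin g → Matrix.ProjGenLinGroup (Fin 2) k)
    (B : Fin g → ℤˣ → Set (ProjLine k)) : Prop where
  isClosed : ∀ i ε, IsClosed (B i ε)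
  disjoint : Pairwise fun p q : Fin g × ℤˣ => Disjoint (B p.1 p.2) (B q.1 q.2)
  isClosedDisc : ∀ i ε, IsClosedDisc (B i ε)
  maximal : ∀ i ε, Maximal (fun D => IsOpenDisc D ∧ D ⊆ B i ε) (innerDisc γ B i ε)

/-! ### Koebe coordinates and cross-ratios -/

/-- The matrix of `M(α, α', β)`, for `α = [u : v]` and `α' = [u' : v']`. -/
def koebeMatrix {k : Type u} [NormedField k] (α α' : Projectivization k (Fin 2 → k)) (β : k) :
    Matrix (Fin 2) (Fin 2) k :=
  let u := α.rep 0
  let v := α.rep 1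
  let u' := α'.rep 0
  let v' := α'.rep 1
  !![u * v' - β * u' * v, (β - 1) * u * u';
     (1 - β) * v * v', β * u * v' - u' * v]

/-- The determinant `u v' - u' v` for `p = [u : v]` and `q = [u' : v']`. -/
def pairing {k : Type u} [NormedField k] (p q : Projectivization k (Fin 2 → k)) : k :=
  p.rep 0 * q.rep 1 - q.rep 0 * p.rep 1

theorem pairing_ne_zero {k : Type u} [NormedField k] {p q : Projectivization k (Fin 2 → k)}
    (h : p ≠ q) : pairing p q ≠ 0 := by
  have hli := (Projectivization.independent_pair_iff_ne p q).2 h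
  rw [Projectivization.independent_iff] at hli
  have e : Projectivization.rep ∘ ![p, q] = (Matrix.of ![p.rep, q.rep]).row := by
    ext i j
    fin_cases i <;> rfl
  have hM : LinearIndependent k (Matrix.of ![p.rep, q.rep]).row := e ▸ hli
  rw [Matrix.linearIndependent_rows_iff_isUnit, Matrix.isUnit_iff_isUnit_det, isUnit_iff_ne_zero,
    Matrix.det_fin_two] at hM
  intro h0
  apply hM
  simp only [pairing] at h0
  simp only [Matrix.of_apply, Matrix.cons_val_zero, Matrix.cons_val_one]
  linear_combination h0

theorem koebeMatrix_det_ne_zero {k : Type u} [NormedField k]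
    {α α' : Projectivization k (Fin 2 → k)} {β : k} (h : α ≠ α') (hβ : 0 < ‖β‖) :
    (koebeMatrix α α' β).det ≠ 0 := by
  have e : (koebeMatrix α α' β).det = β * pairing α α' ^ 2 := by
    simp only [koebeMatrix, pairing, Matrix.det_fin_two_of]
    ring
  rw [e]
  exact mul_ne_zero (norm_pos_iff.1 hβ) (pow_ne_zero 2 (pairing_ne_zero h))

/-- The element `M(α, α', β)` of `PGL₂(k)` with Koebe coordinates `(α, α', β)`. -/
def koebe {k : Type u} [NormedField k] (α α' : Projectivization k (Fin 2 → k)) (β : k)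
    (h : α ≠ α') (hβ : 0 < ‖β‖) : Matrix.ProjGenLinGroup (Fin 2) k :=
  Matrix.ProjGenLinGroup.mk (Matrix.GeneralLinearGroup.mkOfDetNeZero (koebeMatrix α α' β)
    (koebeMatrix_det_ne_zero h hβ))

/-- The cross-ratio `[a, b; c, d] = ((a - c) (b - d)) / ((a - d) (b - c))`, in homogeneous
coordinates. -/
def crossRatio {k : Type u} [NormedField k] (a b c d : Projectivization k (Fin 2 → k)) : k :=
  (pairing a c * pairing b d) / (pairing a d * pairing b c)

end Berkovich

end

noncomputable section

namespace Berkovich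

/-! ### The strong triangle inequality -/

/-! Fix `i` and choose a coordinate `Z` with its zero at `α i` and its pole at `α' i`, so that `γ i`
becomes `Z ↦ β i * Z`. Let `m` and `M` be the minimum and the maximum of `|Z|` on the other points
of `A`. The three conditions all reduce to `|β i| * M < m` for every `i`.

For the cross-ratios, `|[a, b; α i, α' i]| = |Z(a)| / |Z(b)|` (`norm_crossRatio`).

For the lengths, the two biggest discs are `{|Z| < m}` and `{|Z| > M}`. Their boundary points are
the Gauss points of radii `m` and `M`, and the segment between them has length `M / m`
(`exists_length_lt_iff`). This rests on three facts. The frontier of an open disc is one Gauss point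
(`frontier_openDisc`). Every path between two concentric Gauss points meets all the intermediate
ones (`segment_smul_mk_gaussCone`). The multiplicative length depends neither on the coordinate nor
on the finite extension (`hasLength_smul_gaussSegment_iff`).

Given a Schottky figure, each disc contains the fixed point that its index suggests
(`IsSchottkyFigure.fixedPoint_mem`). Hence the two discs of `γ i` are `{|Z| ≤ r}` and `{|Z| ≥ 1 /
r'}`, and the other points of `A` lie strictly between them. The inclusion of the inner disc gives
`|β i| / r' ≤ r`, so `|β i| * M < |β i| / r' ≤ r < m`.

Conversely, any `r` with `|β i| * M < r < m` gives the discs `{|Z| ≤ r}` and `{|Z| ≥ r / |β i|}`.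
Each disc so obtained contains exactly one element of `A`, and this forces disjointness
(`IsClosedDisc.disjoint`). -/

theorem le_of_forall_pow_le_mul_pow {a b : ℝ} (hb : 0 ≤ b)
    (h : ∀ n : ℕ, a ^ n ≤ (n + 1) * b ^ n) : a ≤ b := by
  refine le_of_forall_gt_imp_ge_of_dense fun c hc => ?_
  have hc0 : 0 < c := hb.trans_lt hc
  rcases hb.eq_or_lt with rfl | hb
  · have := h 1
    norm_num at this
    exact this.trans hc0.le
  obtain ⟨m, hm⟩ : ∃ m : ℕ, ((m + 1 : ℕ) : ℝ) < (c / b) ^ m :=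
    mod_cast Real.exists_natCast_add_one_lt_pow_of_one_lt ((one_lt_div hb).2 hc)
  rw [div_pow, lt_div_iff₀ (by positivity)] at hm
  push_cast at hm
  refine le_of_pow_le_pow_left₀ (n := m) ?_ hc0.le ((h m).trans hm.le)
  rintro rfl
  simp at hm

/-- By the binomial formula `p (x + y) ^ n` is at most `n + 1` times the `n`-th power of the
maximum, since the binomial coefficients have seminorm at most `1`. The factor `n + 1` disappears on
taking `n`-th roots. -/
theorem mulRingSeminorm_add_le_max {R : Type*} [CommRing R] (p : MulRingSeminorm R)
    (hp : ∀ n : ℕ, p n ≤ 1) (x y : R) : p (x + y) ≤ max (p x) (p y) := by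
  refine le_of_forall_pow_le_mul_pow (le_max_of_le_left (apply_nonneg _ _)) fun n => ?_
  rw [← map_pow, add_pow]
  have hsum : ∀ (s : Finset ℕ) (f : ℕ → R), p (∑ i ∈ s, f i) ≤ ∑ i ∈ s, p (f i) := fun s f =>
    Finset.le_sum_of_subadditive p (map_zero p).le (map_add_le_add p) s f
  refine (hsum _ _).trans ?_
  have : ∀ i ∈ Finset.range (n + 1), p (x ^ i * y ^ (n - i) * (n.choose i : R)) ≤
      max (p x) (p y) ^ n := by
    intro i hi
    have hin : i + (n - i) = n := by
      have := Finset.mem_range.1 hi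
      omega
    rw [map_mul, map_mul, map_pow, map_pow]
    conv_rhs => rw [← hin, pow_add, ← mul_one (_ * _)]
    have hx := apply_nonneg p x
    have hy := apply_nonneg p y
    gcongr
    · exact le_max_left _ _
    · exact le_max_right _ _
    · exact hp _
  refine (Finset.sum_le_sum this).trans ?_
  simp

section

variable {k : Type u} [NormedField k]

theorem ConePoint.add_le_max [IsUltrametricDist k] (y : ConePoint k)
    (F G : MvPolynomial (Fin 2) k) :
    y.seminorm (F + G) ≤ max (y.seminorm F) (y.seminorm G) := by
  refine mulRingSeminorm_add_le_max _ (fun n => ?_) F G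
  have := y.map_C n
  rw [map_natCast] at this
  rw [this]
  exact IsUltrametricDist.norm_natCast_le_one k n

theorem ConePoint.sum_le [IsUltrametricDist k] (y : ConePoint k) {ι : Type*} (s : Finset ι)
    (f : ι → MvPolynomial (Fin 2) k) {B : ℝ} (hB : 0 ≤ B) (h : ∀ i ∈ s, y.seminorm (f i) ≤ B) :
    y.seminorm (∑ i ∈ s, f i) ≤ B := by
  classical
  induction s using Finset.induction_on with
  | empty => simpa using hB
  | insert a s ha ih =>
    rw [Finset.sum_insert ha]
    exact (y.add_le_max _ _).trans (max_le (h _ (Finset.mem_insert_self _ _))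
      (ih fun i hi => h i (Finset.mem_insert_of_mem hi)))

theorem ConePoint.seminorm_C_mul (y : ConePoint k) (c : k) (F : MvPolynomial (Fin 2) k) :
    y.seminorm (MvPolynomial.C c * F) = ‖c‖ * y.seminorm F := by
  rw [map_mul, y.map_C]

theorem ProjLine.ind {motive : ProjLine k → Prop} (h : ∀ y, motive (ProjLine.mk y))
    (x : ProjLine k) : motive x :=
  Quotient.inductionOn x h

theorem ProjLine.mk_eq_iff {y z : ConePoint k} :
    ProjLine.mk y = ProjLine.mk z ↔ ∃ C : ℝ, 0 < C ∧ ∀ (d : ℕ) (F : MvPolynomial (Fin 2) k),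
      F.IsHomogeneous d → y.seminorm F = C ^ d * z.seminorm F :=
  Quotient.eq (r := coneSetoid k)

theorem pgl_mk_smul_set (g : GL (Fin 2) k) (S : Set (ProjLine k)) :
    Matrix.ProjGenLinGroup.mk g • S = g • S := rfl

/-! ### Linear forms -/

/-- The linear form that vanishes at the vector `w`. -/
def form (w : Fin 2 → k) : MvPolynomial (Fin 2) k :=
  MvPolynomial.C (w 1) * MvPolynomial.X 0 - MvPolynomial.C (w 0) * MvPolynomial.X 1

theorem form_isHomogeneous (w : Fin 2 → k) : (form w).IsHomogeneous 1 :=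
  (MvPolynomial.isHomogeneous_C_mul_X _ _).sub (MvPolynomial.isHomogeneous_C_mul_X _ _)

/-- The absolute value at `y` of the linear form that vanishes at `w`. -/
def absForm (w : Fin 2 → k) (y : ConePoint k) : ℝ := y.seminorm (form w)

theorem absForm_nonneg (w : Fin 2 → k) (y : ConePoint k) : 0 ≤ absForm w y := apply_nonneg _ _

theorem absForm_smul (c : k) (w : Fin 2 → k) (y : ConePoint k) :
    absForm (c • w) y = ‖c‖ * absForm w y := by
  rw [absForm, absForm, ← y.seminorm_C_mul]
  congr 1
  simp only [form, Pi.smul_apply, smul_eq_mul, map_mul]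
  ring

theorem absForm_add_le [IsUltrametricDist k] (w w' : Fin 2 → k) (y : ConePoint k) :
    absForm (w + w') y ≤ max (absForm w y) (absForm w' y) := by
  have : form (w + w') = form w + form w' := by
    simp only [form, Pi.add_apply, map_add]
    ring
  rw [absForm, this]
  exact y.add_le_max _ _

/-- The determinant of two vectors. -/
def bracket (w w' : Fin 2 → k) : k := w 0 * w' 1 - w' 0 * w 1

theorem bracket_swap (w w' : Fin 2 → k) : bracket w' w = -bracket w w' := by
  simp only [bracket]; ring

theorem norm_bracket_comm (w w' : Fin 2 → k) : ‖bracket w' w‖ = ‖bracket w w'‖ := by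
  rw [bracket_swap, norm_neg]

theorem bracket_self (w : Fin 2 → k) : bracket w w = 0 := by
  simp only [bracket]; ring

theorem right_ne_zero_of_bracket {w w' : Fin 2 → k} (h : bracket w w' ≠ 0) : w' ≠ 0 := by
  rintro rfl
  simp [bracket] at h

theorem exists_smul_of_bracket_eq_zero {p w : Fin 2 → k} (hp : p ≠ 0) (h : bracket p w = 0) :
    ∃ c : k, w = c • p := by
  rw [bracket, sub_eq_zero] at h
  by_cases h0 : p 0 = 0
  · have h1 : p 1 ≠ 0 := by
      intro h1
      apply hp
      ext i
      fin_cases i <;> simp [h0, h1]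
    refine ⟨w 1 / p 1, ?_⟩
    ext i
    fin_cases i
    · simpa [h0, h1] using h
    · simp [h1]
  · refine ⟨w 0 / p 0, ?_⟩
    ext i
    fin_cases i
    · simp [h0]
    · simp only [Fin.mk_one, Pi.smul_apply, smul_eq_mul]
      field_simp
      linear_combination h

theorem pairing_eq_bracket (p q : Projectivization k (Fin 2 → k)) :
    pairing p q = bracket p.rep q.rep := rfl

theorem bracket_rep_ne_zero {p q : Projectivization k (Fin 2 → k)} (h : p ≠ q) :
    bracket p.rep q.rep ≠ 0 := pairing_ne_zero h

theorem absForm_ofVec (w p : Fin 2 → k) (hp : p ≠ 0) :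
    absForm w (ConePoint.ofVec p hp) = ‖bracket p w‖ := by
  change ‖MvPolynomial.eval p (form w)‖ = _
  congr 1
  simp only [form, bracket, map_sub, map_mul, MvPolynomial.eval_C, MvPolynomial.eval_X]
  ring

theorem seminorm_X_one (y : ConePoint k) :
    y.seminorm (MvPolynomial.X 1) = absForm ![1, 0] y := by
  simp [absForm, form]

theorem seminorm_X_zero (y : ConePoint k) :
    y.seminorm (MvPolynomial.X 0) = absForm ![0, 1] y := by
  simp [absForm, form]

theorem seminorm_X_sub (a : k) (y : ConePoint k) :
    y.seminorm (MvPolynomial.X 0 - MvPolynomial.C a * MvPolynomial.X 1) = absForm ![a, 1] y := by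
  simp [absForm, form]

/-- Cramer's rule for the linear forms. -/
theorem smul_eq_bracket_smul_add (p q w : Fin 2 → k) :
    bracket p q • w = bracket w q • p + bracket p w • q := by
  ext i
  fin_cases i <;> simp [bracket] <;> ring

/-- The ultrametric inequality applied to Cramer's rule. Comparisons between discs with different
centers rest on this three-point estimate. -/
theorem norm_bracket_mul_absForm_le [IsUltrametricDist k] (p q w : Fin 2 → k)
    (y : ConePoint k) :
    ‖bracket p q‖ * absForm w y ≤
      max (‖bracket w q‖ * absForm p y) (‖bracket p w‖ * absForm q y) := by
  rw [← absForm_smul, smul_eq_bracket_smul_add, ← absForm_smul, ← absForm_smul]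
  exact absForm_add_le _ _ _

/-- Two independent linear forms that vanish at `y` would make every linear form vanish there,
including both coordinates. -/
theorem absForm_pos_or_pos [IsUltrametricDist k] {p q : Fin 2 → k} (h : bracket p q ≠ 0)
    (y : ConePoint k) : 0 < absForm p y ∨ 0 < absForm q y := by
  by_contra! hcon
  have hp := le_antisymm hcon.1 (absForm_nonneg _ _)
  have hq := le_antisymm hcon.2 (absForm_nonneg _ _)
  have key : ∀ w, absForm w y = 0 := by
    intro w
    have := norm_bracket_mul_absForm_le p q w y
    rw [hp, hq, mul_zero, mul_zero, max_self] at this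
    refine le_antisymm ?_ (absForm_nonneg _ _)
    exact nonpos_of_mul_nonpos_right this (norm_pos_iff.2 h)
  obtain ⟨i, hi⟩ := y.exists_ne_zero
  fin_cases i
  · exact hi ((seminorm_X_zero y).trans (key _))
  · exact hi ((seminorm_X_one y).trans (key _))

/-- The form vanishing at `g w`, pulled back by `g`, is `det g` times the form vanishing at `w`. The
determinant cancels in quotients of two forms, so coordinates are transported by moving their zero
and pole. -/
theorem absForm_mulVec (g : GL (Fin 2) k) (w : Fin 2 → k) (y : ConePoint k) :
    absForm (g.1.mulVec w) (g • y) = ‖g.1.det‖ * absForm w y := by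
  rw [absForm, absForm, smul_seminorm, ← y.seminorm_C_mul]
  congr 1
  simp only [form, subst, map_sub, map_mul, MvPolynomial.algHom_C, MvPolynomial.aeval_X,
    Matrix.mulVec, dotProduct, Fin.sum_univ_two, map_add, Matrix.det_fin_two,
    MvPolynomial.algebraMap_eq]
  ring

theorem bracket_mulVec (g : Matrix (Fin 2) (Fin 2) k) (w w' : Fin 2 → k) :
    bracket (g.mulVec w) (g.mulVec w') = g.det * bracket w w' := by
  simp only [bracket, Matrix.mulVec, dotProduct, Fin.sum_univ_two, Matrix.det_fin_two]
  ring

theorem norm_det_pos (g : GL (Fin 2) k) : 0 < ‖g.1.det‖ :=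
  norm_pos_iff.2 (g.isUnit.map Matrix.detMonoidHom).ne_zero

/-- The element of `GL₂(k)` that sends `[1 : 0]` to `q` and `[0 : 1]` to `p`. -/
def frame (p q : Fin 2 → k) (h : bracket p q ≠ 0) : GL (Fin 2) k :=
  Matrix.GeneralLinearGroup.mkOfDetNeZero !![q 0, p 0; q 1, p 1] (by
    rw [Matrix.det_fin_two_of]
    intro h'
    apply h
    rw [bracket]
    linear_combination -h')

theorem frame_val (p q : Fin 2 → k) (h : bracket p q ≠ 0) :
    (frame p q h).1 = !![q 0, p 0; q 1, p 1] := rfl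

theorem frame_mulVec_zero (p q : Fin 2 → k) (h : bracket p q ≠ 0) :
    (frame p q h).1.mulVec ![0, 1] = p := by
  ext i
  fin_cases i <;> simp [frame_val, Matrix.mulVec, dotProduct, Fin.sum_univ_two]

theorem frame_mulVec_infty (p q : Fin 2 → k) (h : bracket p q ≠ 0) :
    (frame p q h).1.mulVec ![1, 0] = q := by
  ext i
  fin_cases i <;> simp [frame_val, Matrix.mulVec, dotProduct, Fin.sum_univ_two]

end

/-! ### Gauss points -/

section

variable {k : Type u} [NormedField k] {k' : Type u} [NormedField k'] [NormedAlgebra k k']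

theorem isUltrametricDist_of_normedAlgebra [IsUltrametricDist k] : IsUltrametricDist k' := by
  refine IsUltrametricDist.isUltrametricDist_of_forall_norm_natCast_le_one fun n => ?_
  rw [← map_natCast (algebraMap k k'), norm_algebraMap']
  exact IsUltrametricDist.norm_natCast_le_one k n

theorem toAbsoluteValue_apply {K : Type*} [NormedField K] (x : K) :
    NormedField.toAbsoluteValue K x = ‖x‖ := rfl

theorem isNonarchimedean_toAbsoluteValue (K : Type*) [NormedField K] [IsUltrametricDist K] :
    IsNonarchimedean (NormedField.toAbsoluteValue K) := fun x y =>
  IsUltrametricDist.norm_add_le_max x y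

/-- The restriction of a polynomial in homogeneous coordinates to the affine line, in the
coordinate centered at `a`. -/
def dehomogenize (k : Type u) [NormedField k] {k' : Type u} [NormedField k'] [NormedAlgebra k k']
    (a : k') : MvPolynomial (Fin 2) k →ₐ[k] Polynomial k' :=
  MvPolynomial.aeval ![(Polynomial.X + Polynomial.C a : Polynomial k'), 1]

theorem dehomogenize_C (a : k') (c : k) :
    dehomogenize k a (MvPolynomial.C c) = Polynomial.C (algebraMap k k' c) := by
  rw [dehomogenize, MvPolynomial.algHom_C]
  rfl

theorem dehomogenize_X_zero (a : k') :
    dehomogenize k a (MvPolynomial.X 0) = Polynomial.X + Polynomial.C a := by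
  simp [dehomogenize]

theorem dehomogenize_X_one (a : k') : dehomogenize k a (MvPolynomial.X 1) = 1 := by
  simp [dehomogenize]

/-- The Gauss point `η_{a,t}`, with `|X₁| = 1`. -/
def gaussCone (k : Type u) [NormedField k] [IsUltrametricDist k] {k' : Type u} [NormedField k']
    [NormedAlgebra k k'] (a : k') (t : ℝ) (ht : 0 < t) : ConePoint k where
  seminorm :=
    { toFun := fun F => (dehomogenize k a F).gaussNorm (NormedField.toAbsoluteValue k') t
      map_zero' := by simp
      add_le' := fun F G => by
        have : IsUltrametricDist k' := isUltrametricDist_of_normedAlgebra (k := k)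
        rw [map_add]
        refine (Polynomial.isNonarchimedean_gaussNorm _ (isNonarchimedean_toAbsoluteValue k')
          ht.le _ _).trans (max_le ?_ ?_)
        · exact le_add_of_nonneg_right (Polynomial.gaussNorm_nonneg _ _ ht.le)
        · exact le_add_of_nonneg_left (Polynomial.gaussNorm_nonneg _ _ ht.le)
      neg' := fun F => by
        have : IsUltrametricDist k' := isUltrametricDist_of_normedAlgebra (k := k)
        rw [map_neg, ← neg_one_mul, Polynomial.gaussNorm_mul (isNonarchimedean_toAbsoluteValue k')
          ht, ← Polynomial.C_1, ← Polynomial.C_neg, Polynomial.gaussNorm_C]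
        simp
      map_one' := by
        rw [map_one, ← Polynomial.C_1, Polynomial.gaussNorm_C, map_one]
      map_mul' := fun F G => by
        have : IsUltrametricDist k' := isUltrametricDist_of_normedAlgebra (k := k)
        rw [map_mul, Polynomial.gaussNorm_mul (isNonarchimedean_toAbsoluteValue k') ht] }
  map_C := fun c => by
    change (dehomogenize k a (MvPolynomial.C c)).gaussNorm (NormedField.toAbsoluteValue k') t = ‖c‖
    rw [dehomogenize_C, Polynomial.gaussNorm_C]
    exact norm_algebraMap' k' c
  exists_ne_zero := ⟨1, by
    change (dehomogenize k a (MvPolynomial.X 1)).gaussNorm (NormedField.toAbsoluteValue k') t ≠ 0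
    rw [dehomogenize_X_one, ← Polynomial.C_1, Polynomial.gaussNorm_C, map_one]
    exact one_ne_zero⟩

variable [IsUltrametricDist k]

theorem gaussCone_seminorm (a : k') {t : ℝ} (ht : 0 < t) (F : MvPolynomial (Fin 2) k) :
    (gaussCone k a t ht).seminorm F =
      (dehomogenize k a F).gaussNorm (NormedField.toAbsoluteValue k') t := rfl

theorem isEta_gaussCone (a : k') {t : ℝ} (ht : 0 < t) :
    IsEta a t (ProjLine.mk (gaussCone k a t ht)) := ⟨_, rfl, fun _ => rfl⟩

theorem isEta_iff (a : k') {t : ℝ} (ht : 0 < t) (x : ProjLine k) :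
    IsEta a t x ↔ x = ProjLine.mk (gaussCone k a t ht) := by
  refine ⟨?_, fun h => h ▸ isEta_gaussCone a ht⟩
  rintro ⟨y, rfl, h⟩
  exact congrArg _ (ConePoint.ext h)

theorem gaussNorm_C_mul_X_add_C {K : Type*} [NormedField K] {t : ℝ} (ht : 0 ≤ t) (b c : K) :
    (Polynomial.C b * Polynomial.X + Polynomial.C c).gaussNorm (NormedField.toAbsoluteValue K) t =
      max (‖b‖ * t) ‖c‖ := by
  apply le_antisymm
  · obtain ⟨i, hi⟩ := Polynomial.exists_eq_gaussNorm (NormedField.toAbsoluteValue K) t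
      (Polynomial.C b * Polynomial.X + Polynomial.C c)
    rw [hi]
    rcases i with _ | _ | i
    · refine le_max_of_le_right ?_
      simp [toAbsoluteValue_apply]
    · refine le_max_of_le_left ?_
      simp [Polynomial.coeff_C, toAbsoluteValue_apply]
    · have : (Polynomial.C b * Polynomial.X + Polynomial.C c).coeff (i + 1 + 1) = 0 := by
        simp
      rw [this, map_zero, zero_mul]
      exact le_max_of_le_right (norm_nonneg _)
  · refine max_le ?_ ?_
    · have := Polynomial.le_gaussNorm (NormedField.toAbsoluteValue K)
        (Polynomial.C b * Polynomial.X + Polynomial.C c) ht 1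
      simpa [Polynomial.coeff_C, toAbsoluteValue_apply] using this
    · have := Polynomial.le_gaussNorm (NormedField.toAbsoluteValue K)
        (Polynomial.C b * Polynomial.X + Polynomial.C c) ht 0
      simpa [toAbsoluteValue_apply] using this

theorem absForm_gaussCone' (w : Fin 2 → k) (a : k') {t : ℝ} (ht : 0 < t) :
    absForm w (gaussCone k a t ht) =
      max (‖w 1‖ * t) ‖algebraMap k k' (w 1) * a - algebraMap k k' (w 0)‖ := by
  have h : dehomogenize k a (form w) = Polynomial.C (algebraMap k k' (w 1)) * Polynomial.X +
      Polynomial.C (algebraMap k k' (w 1) * a - algebraMap k k' (w 0)) := by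
    rw [form, map_sub, map_mul, map_mul, dehomogenize_C, dehomogenize_C, dehomogenize_X_zero,
      dehomogenize_X_one, map_sub, map_mul]
    ring
  rw [absForm, gaussCone_seminorm, h, gaussNorm_C_mul_X_add_C ht.le, norm_algebraMap']

theorem absForm_gaussCone (w : Fin 2 → k) (a : k) {t : ℝ} (ht : 0 < t) :
    absForm w (gaussCone k a t ht) = max (‖w 1‖ * t) ‖w 1 * a - w 0‖ :=
  absForm_gaussCone' w a ht

theorem X_pow_mul_X_pow_eq_sum {K : Type u} [NormedField K] (a : K) {n d : ℕ} (hn : n ≤ d) :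
    (MvPolynomial.X 0 ^ n * MvPolynomial.X 1 ^ (d - n) : MvPolynomial (Fin 2) K) =
      ∑ i ∈ Finset.range (d + 1),
        MvPolynomial.C (((Polynomial.X + Polynomial.C a) ^ n : Polynomial K).coeff i) *
        ((MvPolynomial.X 0 - MvPolynomial.C a * MvPolynomial.X 1) ^ i *
          MvPolynomial.X 1 ^ (d - i)) := by
  have h0 : (MvPolynomial.X 0 : MvPolynomial (Fin 2) K) =
      (MvPolynomial.X 0 - MvPolynomial.C a * MvPolynomial.X 1) +
        MvPolynomial.C a * MvPolynomial.X 1 := by ring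
  conv_lhs => rw [h0, add_pow, Finset.sum_mul]
  rw [← Finset.sum_subset (Finset.range_subset_range.2 (Nat.succ_le_succ hn))]
  · refine Finset.sum_congr rfl fun i hi => ?_
    have hi' : i ≤ n := Nat.lt_succ_iff.1 (Finset.mem_range.1 hi)
    have hd : d - i = (n - i) + (d - n) := by omega
    rw [Polynomial.coeff_X_add_C_pow, hd, pow_add, mul_pow, map_mul, map_pow, map_natCast]
    ring
  · intro i _ hi
    have hi' : n < i := by
      by_contra h
      exact hi (Finset.mem_range.2 (by omega))
    rw [Polynomial.coeff_X_add_C_pow, Nat.choose_eq_zero_of_lt hi']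
    simp

/-- A homogeneous polynomial is determined by its restriction to the affine line. -/
theorem eq_sum_of_isHomogeneous {K : Type u} [NormedField K] (a : K) {d : ℕ}
    {F : MvPolynomial (Fin 2) K} (hF : F.IsHomogeneous d) :
    F = ∑ i ∈ Finset.range (d + 1), MvPolynomial.C ((dehomogenize K a F).coeff i) *
      ((MvPolynomial.X 0 - MvPolynomial.C a * MvPolynomial.X 1) ^ i *
        MvPolynomial.X 1 ^ (d - i)) := by
  have hdeg : ∀ m ∈ F.support, m 0 + m 1 = d := by
    intro m hm
    have := hF (MvPolynomial.mem_support_iff.1 hm)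
    rwa [Finsupp.weight_apply, Finsupp.sum_fintype _ _ (by simp), Fin.sum_univ_two,
      Pi.one_apply, Pi.one_apply, smul_eq_mul, smul_eq_mul, mul_one, mul_one] at this
  have hmon : ∀ m : Fin 2 →₀ ℕ, (MvPolynomial.monomial m (F.coeff m) : MvPolynomial (Fin 2) K) =
      MvPolynomial.C (F.coeff m) * (MvPolynomial.X 0 ^ m 0 * MvPolynomial.X 1 ^ m 1) := by
    intro m
    rw [MvPolynomial.monomial_eq, Finsupp.prod_fintype _ _ (by simp), Fin.prod_univ_two]
  have hP : dehomogenize K a F = ∑ m ∈ F.support, Polynomial.C (F.coeff m) *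
      (Polynomial.X + Polynomial.C a) ^ m 0 := by
    conv_lhs => rw [F.as_sum]
    rw [map_sum]
    refine Finset.sum_congr rfl fun m _ => ?_
    rw [hmon, map_mul, map_mul, map_pow, map_pow, dehomogenize_C, dehomogenize_X_zero,
      dehomogenize_X_one, one_pow, mul_one]
    rfl
  conv_lhs => rw [F.as_sum]
  simp only [hP, Polynomial.finsetSum_coeff, Polynomial.coeff_C_mul, map_sum, map_mul,
    Finset.sum_mul]
  rw [Finset.sum_comm]
  refine Finset.sum_congr rfl fun m hm => ?_
  have h1 : m 1 = d - m 0 := by have := hdeg m hm; omega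
  rw [hmon, h1, X_pow_mul_X_pow_eq_sum a (by have := hdeg m hm; omega), Finset.mul_sum]
  exact Finset.sum_congr rfl fun i _ => by ring

end

/-! ### Images of Gauss points under Möbius transformations. -/

section

variable {k : Type u} [NormedField k]

theorem absForm_gl_smul (g : GL (Fin 2) k) (w : Fin 2 → k) (y : ConePoint k) :
    absForm w (g • y) =
      absForm ![g.1 1 1 * w 0 - g.1 0 1 * w 1, g.1 0 0 * w 1 - g.1 1 0 * w 0] y := by
  rw [absForm, absForm, smul_seminorm]
  congr 1
  simp only [form, subst, map_sub, map_mul, MvPolynomial.algHom_C, MvPolynomial.aeval_X,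
    Fin.sum_univ_two, MvPolynomial.algebraMap_eq, Matrix.cons_val_zero, Matrix.cons_val_one]
  ring

theorem absForm_gl_inv_smul (g : GL (Fin 2) k) (w : Fin 2 → k) (y : ConePoint k) :
    absForm w (g⁻¹ • y) = absForm (g.1.mulVec w) y / ‖g.1.det‖ := by
  rw [eq_div_iff (norm_det_pos g).ne', mul_comm, ← absForm_mulVec, smul_inv_smul]

/-- The radius of the image of `η_{0,t}` by a Möbius transformation. -/
def imageRadius (g : GL (Fin 2) k) (t : ℝ) : ℝ :=
  ‖g.1.det‖ * t / max (‖g.1 1 0‖ * t) ‖g.1 1 1‖ ^ 2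

theorem max_bottom_pos (g : GL (Fin 2) k) {t : ℝ} (ht : 0 < t) :
    0 < max (‖g.1 1 0‖ * t) ‖g.1 1 1‖ := by
  by_cases h : g.1 1 0 = 0
  · refine lt_max_of_lt_right (norm_pos_iff.2 fun h' => ?_)
    have := norm_det_pos g
    rw [Matrix.det_fin_two, h, h', mul_zero, mul_zero, sub_zero, norm_zero] at this
    exact this.false
  · exact lt_max_of_lt_left (mul_pos (norm_pos_iff.2 h) ht)

theorem imageRadius_pos (g : GL (Fin 2) k) {t : ℝ} (ht : 0 < t) : 0 < imageRadius g t :=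
  div_pos (mul_pos (norm_det_pos g) ht) (pow_pos (max_bottom_pos g ht) 2)

variable [IsUltrametricDist k]

/-- The Gauss point `η_{a,u}` is the maximal point of the disc `D⁺(a, u)`. -/
theorem seminorm_le_gaussCone (z : ConePoint k) (a : k) {u : ℝ} (hu : 0 < u)
    (h : absForm ![a, 1] z ≤ u * absForm ![1, 0] z) {d : ℕ} {F : MvPolynomial (Fin 2) k}
    (hF : F.IsHomogeneous d) :
    z.seminorm F ≤ absForm ![1, 0] z ^ d * (gaussCone k a u hu).seminorm F := by
  have h1 := absForm_nonneg ![1, 0] z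
  conv_lhs => rw [eq_sum_of_isHomogeneous a hF]
  refine z.sum_le _ _ (mul_nonneg (pow_nonneg h1 _) (apply_nonneg _ _)) fun i hi => ?_
  have hi' : i ≤ d := Nat.lt_succ_iff.1 (Finset.mem_range.1 hi)
  rw [z.seminorm_C_mul, map_mul, map_pow, map_pow, seminorm_X_sub, seminorm_X_one,
    gaussCone_seminorm]
  have h2 := Polynomial.le_gaussNorm (NormedField.toAbsoluteValue k) (dehomogenize k a F) hu.le i
  rw [toAbsoluteValue_apply] at h2
  calc ‖(dehomogenize k a F).coeff i‖ * (absForm ![a, 1] z ^ i * absForm ![1, 0] z ^ (d - i))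
      ≤ ‖(dehomogenize k a F).coeff i‖ *
          ((u * absForm ![1, 0] z) ^ i * absForm ![1, 0] z ^ (d - i)) := by
        gcongr
        exact absForm_nonneg _ _
    _ = absForm ![1, 0] z ^ d * (‖(dehomogenize k a F).coeff i‖ * u ^ i) := by
        rw [mul_pow]
        conv_rhs => rw [← Nat.add_sub_cancel' hi', pow_add]
        ring
    _ ≤ _ := by gcongr

/-- Maximality of Gauss points is used in both directions: `h1` bounds `g η_{a,t}` by `η_{c,u}`, and
`h2` bounds `g⁻¹ η_{c,u}` by `η_{a,t}`. By `h3` the two scaling factors are inverse to each other,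
so the bounds are equalities. -/
theorem smul_mk_gaussCone_eq (g : GL (Fin 2) k) (a c : k) {t u : ℝ} (ht : 0 < t) (hu : 0 < u)
    (h1 : absForm ![c, 1] (g • gaussCone k a t ht) ≤
      u * absForm ![1, 0] (g • gaussCone k a t ht))
    (h2 : absForm ![a, 1] (g⁻¹ • gaussCone k c u hu) ≤
      t * absForm ![1, 0] (g⁻¹ • gaussCone k c u hu))
    (h3 : absForm ![1, 0] (g • gaussCone k a t ht) *
      absForm ![1, 0] (g⁻¹ • gaussCone k c u hu) = 1) :
    g • ProjLine.mk (gaussCone k a t ht) = ProjLine.mk (gaussCone k c u hu) := by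
  rw [smul_mk, ProjLine.mk_eq_iff]
  have hN : 0 < absForm ![1, 0] (g • gaussCone k a t ht) := by
    refine (absForm_nonneg _ _).lt_of_ne fun h => ?_
    rw [← h, zero_mul] at h3
    exact zero_ne_one h3
  refine ⟨_, hN, fun d F hF => le_antisymm (seminorm_le_gaussCone _ c hu h1 hF) ?_⟩
  have h4 := seminorm_le_gaussCone _ a ht h2 (subst_isHomogeneous g.1 hF)
  rw [← smul_seminorm, ← smul_seminorm, smul_inv_smul] at h4
  calc _ ≤ absForm ![1, 0] (g • gaussCone k a t ht) ^ d * _ :=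
        mul_le_mul_of_nonneg_left h4 (pow_nonneg hN.le _)
    _ = _ := by rw [← mul_assoc, ← mul_pow, h3, one_pow, one_mul]

/-- If the pole of `g` is not in `{|Z| < t}`, the image is centered at `g(0) = g₀₁ / g₁₁`. Otherwise
it is centered at `g(∞) = g₀₀ / g₁₀`. -/
theorem exists_smul_mk_gaussCone (g : GL (Fin 2) k) {t : ℝ} (ht : 0 < t) :
    ∃ c : k, g • ProjLine.mk (gaussCone k (0 : k) t ht) =
      ProjLine.mk (gaussCone k c (imageRadius g t) (imageRadius_pos g ht)) := by
  have hδ := norm_det_pos g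
  have hδ' : g.1.det ≠ 0 := norm_pos_iff.1 hδ
  have hN := max_bottom_pos g ht
  have hdet := Matrix.det_fin_two g.1
  have hu := imageRadius_pos g ht
  have hu' : imageRadius g t = ‖g.1.det‖ * t / max (‖g.1 1 0‖ * t) ‖g.1 1 1‖ ^ 2 := rfl
  set u := imageRadius g t with hudef
  rcases le_or_gt (‖g.1 1 0‖ * t) ‖g.1 1 1‖ with hle | hlt
  · rw [max_eq_right hle] at hN hu'
    have hD : g.1 1 1 ≠ 0 := norm_pos_iff.1 hN
    have e1 : g.1 1 1 * (g.1 0 1 / g.1 1 1) - g.1 0 1 = 0 := by field_simp; ring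
    have e2 : g.1 0 0 - g.1 1 0 * (g.1 0 1 / g.1 1 1) = g.1.det / g.1 1 1 := by
      rw [hdet]; field_simp
    have f1 : absForm ![1, 0] (g • gaussCone k (0 : k) t ht) = ‖g.1 1 1‖ := by
      rw [absForm_gl_smul, absForm_gaussCone]
      simpa using hle
    have f2 : absForm ![1, 0] (g⁻¹ • gaussCone k (g.1 0 1 / g.1 1 1) u hu) = ‖g.1 1 1‖⁻¹ := by
      rw [absForm_gl_inv_smul, absForm_gaussCone]
      simp only [Matrix.mulVec, dotProduct, Fin.sum_univ_two, Matrix.cons_val_zero,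
        Matrix.cons_val_one, mul_one, mul_zero, add_zero]
      rw [norm_sub_rev, e2, norm_div, max_eq_right]
      · field_simp
      · rw [hu', ← mul_div_assoc, div_le_div_iff₀ (by positivity) hN]
        nlinarith [mul_le_mul_of_nonneg_left hle (mul_pos hδ hN).le]
    refine ⟨g.1 0 1 / g.1 1 1, smul_mk_gaussCone_eq g _ _ ht hu ?_ ?_ ?_⟩
    · rw [f1, absForm_gl_smul, absForm_gaussCone]
      simp only [Matrix.cons_val_zero, Matrix.cons_val_one, mul_one, mul_zero, zero_sub, norm_neg]
      rw [e1, e2, norm_zero, norm_div, hu']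
      refine max_le (le_of_eq ?_) (by positivity)
      field_simp
    · rw [f2, absForm_gl_inv_smul, absForm_gaussCone]
      simp only [Matrix.mulVec, dotProduct, Fin.sum_univ_two, Matrix.cons_val_zero,
        Matrix.cons_val_one, mul_one, mul_zero, zero_add]
      rw [e1, norm_zero, max_eq_left (by positivity), hu']
      refine le_of_eq ?_
      field_simp
    · rw [f1, f2, mul_inv_cancel₀ hN.ne']
  · rw [max_eq_left hlt.le] at hN hu'
    have hC' : 0 < ‖g.1 1 0‖ := pos_of_mul_pos_left hN ht.le
    have hC : g.1 1 0 ≠ 0 := norm_pos_iff.1 hC'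
    have e1 : g.1 0 0 - g.1 1 0 * (g.1 0 0 / g.1 1 0) = 0 := by field_simp; ring
    have e2 : g.1 1 1 * (g.1 0 0 / g.1 1 0) - g.1 0 1 = g.1.det / g.1 1 0 := by
      rw [hdet]; field_simp
    have f1 : absForm ![1, 0] (g • gaussCone k (0 : k) t ht) = ‖g.1 1 0‖ * t := by
      rw [absForm_gl_smul, absForm_gaussCone]
      simpa using hlt.le
    have f2 : absForm ![1, 0] (g⁻¹ • gaussCone k (g.1 0 0 / g.1 1 0) u hu) =
        (‖g.1 1 0‖ * t)⁻¹ := by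
      rw [absForm_gl_inv_smul, absForm_gaussCone]
      simp only [Matrix.mulVec, dotProduct, Fin.sum_univ_two, Matrix.cons_val_zero,
        Matrix.cons_val_one, mul_one, mul_zero, add_zero]
      rw [norm_sub_rev, e1, norm_zero, max_eq_left (by positivity), hu']
      field_simp
    refine ⟨g.1 0 0 / g.1 1 0, smul_mk_gaussCone_eq g _ _ ht hu ?_ ?_ ?_⟩
    · rw [f1, absForm_gl_smul, absForm_gaussCone]
      simp only [Matrix.cons_val_zero, Matrix.cons_val_one, mul_one, mul_zero, zero_sub, norm_neg]
      rw [e1, e2, norm_zero, zero_mul, norm_div, hu']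
      refine max_le (by positivity) (le_of_eq ?_)
      field_simp
    · rw [f2, absForm_gl_inv_smul, absForm_gaussCone]
      simp only [Matrix.mulVec, dotProduct, Fin.sum_univ_two, Matrix.cons_val_zero,
        Matrix.cons_val_one, mul_one, mul_zero, zero_add]
      rw [e2, norm_div, div_le_iff₀ hδ, hu']
      refine max_le ?_ (le_of_eq ?_)
      · have : t * (‖g.1 1 0‖ * t)⁻¹ * ‖g.1.det‖ = (‖g.1 1 0‖ * t) *
            (‖g.1.det‖ * t / (‖g.1 1 0‖ * t) ^ 2) := by field_simp
        rw [this]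
        gcongr
      · field_simp
    · rw [f1, f2, mul_inv_cancel₀ hN.ne']

end

/-! ### The radius of a Gauss point -/

section

variable {k : Type u} [NormedField k] {k' : Type u} [NormedField k'] [NormedAlgebra k k']

/-- The homogenization of a polynomial in one variable. -/
def homogenize (P : Polynomial k) : MvPolynomial (Fin 2) k :=
  ∑ i ∈ Finset.range (P.natDegree + 1), MvPolynomial.C (P.coeff i) *
    (MvPolynomial.X 0 ^ i * MvPolynomial.X 1 ^ (P.natDegree - i))

theorem homogenize_isHomogeneous (P : Polynomial k) :
    (homogenize P).IsHomogeneous P.natDegree := by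
  refine MvPolynomial.IsHomogeneous.sum _ _ _ fun i hi => ?_
  have hi' : i ≤ P.natDegree := Nat.lt_succ_iff.1 (Finset.mem_range.1 hi)
  have := (MvPolynomial.isHomogeneous_C (Fin 2) (P.coeff i)).mul
    ((MvPolynomial.isHomogeneous_X_pow (R := k) (0 : Fin 2) i).mul
      (MvPolynomial.isHomogeneous_X_pow (R := k) (1 : Fin 2) (P.natDegree - i)))
  rwa [zero_add, Nat.add_sub_cancel' hi'] at this

theorem dehomogenize_homogenize (P : Polynomial k) (a : k') :
    dehomogenize k a (homogenize P) =
      (P.map (algebraMap k k')).comp (Polynomial.X + Polynomial.C a) := by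
  rw [homogenize, map_sum, Polynomial.comp, Polynomial.eval₂_eq_sum_range,
    Polynomial.natDegree_map]
  refine Finset.sum_congr rfl fun i _ => ?_
  rw [map_mul, map_mul, map_pow, map_pow, dehomogenize_C, dehomogenize_X_zero,
    dehomogenize_X_one, one_pow, mul_one, Polynomial.coeff_map]

variable [IsUltrametricDist k]

/-- Without a constant coefficient, the dominant term has positive degree, so it grows strictly with
the radius. -/
theorem gaussNorm_lt_of_coeff_zero {K : Type*} [NormedField K] {Q : Polynomial K} (hQ : Q ≠ 0)
    (h0 : Q.coeff 0 = 0) {t u : ℝ} (ht : 0 < t) (htu : t < u) :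
    Q.gaussNorm (NormedField.toAbsoluteValue K) t <
      Q.gaussNorm (NormedField.toAbsoluteValue K) u := by
  obtain ⟨i, hi⟩ := Polynomial.exists_eq_gaussNorm (NormedField.toAbsoluteValue K) t Q
  have hne : Q.gaussNorm (NormedField.toAbsoluteValue K) t ≠ 0 := fun h =>
    hQ ((Polynomial.gaussNorm_eq_zero_iff _ _ (fun x hx => (AbsoluteValue.eq_zero _).1 hx) ht).1 h)
  have hc : Q.coeff i ≠ 0 := by
    intro h
    rw [h, map_zero, zero_mul] at hi
    exact hne hi
  have hi0 : i ≠ 0 := by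
    rintro rfl
    exact hc h0
  rw [hi]
  refine lt_of_lt_of_le ?_ (Polynomial.le_gaussNorm _ Q (ht.trans htu).le i)
  rw [toAbsoluteValue_apply]
  exact mul_lt_mul_of_pos_left (pow_lt_pow_left₀ htu ht.le hi0) (norm_pos_iff.2 hc)

/-- Evaluating `Z - c` gives `max t |a - c| = u`, so `t ≤ u` and `η_{a,u}` lies in `D⁺(c, u)`. If `t
< u`, the minimal polynomial of `a` over `k` separates the points: it vanishes at `a`, so its value
at `η_{a,t}` is strictly smaller than at `η_{a,u}`, which is at most its value at `η_{c,u}`.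
Algebraicity of `a` is essential here. -/
theorem radius_eq_of_isEta [FiniteDimensional k k'] {a : k'} {c : k} {t u : ℝ} (ht : 0 < t)
    (hu : 0 < u) (h : IsEta a t (ProjLine.mk (gaussCone k c u hu))) : t = u := by
  rw [isEta_iff a ht, ProjLine.mk_eq_iff] at h
  obtain ⟨C, -, hC⟩ := h
  -- Both representatives are normalized by `|X₁| = 1`.
  have hC1 : C = 1 := by
    have := hC 1 _ (form_isHomogeneous ![1, 0])
    rw [← absForm, ← absForm, absForm_gaussCone', absForm_gaussCone'] at this
    simpa using this.symm
  subst hC1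
  simp only [one_pow, one_mul] at hC
  have hle : absForm ![c, 1] (gaussCone k a t ht) = u := by
    rw [absForm, ← hC 1 _ (form_isHomogeneous _), ← absForm, absForm_gaussCone]
    simpa using hu.le
  rw [absForm_gaussCone'] at hle
  simp only [Matrix.cons_val_zero, Matrix.cons_val_one, norm_one, one_mul, map_one] at hle
  have htu : t ≤ u := hle ▸ le_max_left _ _
  refine htu.eq_of_not_lt fun hlt => ?_
  have hint : IsIntegral k a := IsIntegral.of_finite k a
  set P := minpoly k a
  have hP : P ≠ 0 := minpoly.ne_zero hint
  have hQ : dehomogenize k a (homogenize P) ≠ 0 := by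
    rw [dehomogenize_homogenize, Ne, Polynomial.comp_X_add_C_eq_zero_iff,
      Polynomial.map_eq_zero]
    exact hP
  have hQ0 : (dehomogenize k a (homogenize P)).coeff 0 = 0 := by
    rw [dehomogenize_homogenize, Polynomial.coeff_zero_eq_eval_zero, Polynomial.eval_comp]
    simp [Polynomial.eval_map_algebraMap, P]
  have h1 := gaussNorm_lt_of_coeff_zero hQ hQ0 ht hlt
  rw [← gaussCone_seminorm a ht, ← gaussCone_seminorm a hu,
    ← hC _ _ (homogenize_isHomogeneous P)] at h1
  refine h1.not_ge ?_
  have h2 := seminorm_le_gaussCone (gaussCone k a u hu) c hu ?_ (homogenize_isHomogeneous P)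
  · rw [absForm_gaussCone'] at h2
    simpa using h2
  · rw [absForm_gaussCone', absForm_gaussCone']
    simp only [Matrix.cons_val_zero, Matrix.cons_val_one, norm_one, one_mul, map_one, norm_zero,
      zero_mul, map_zero, zero_sub, norm_neg]
    rw [max_eq_right (zero_le_one), mul_one]
    exact max_le le_rfl (hle ▸ le_max_right _ _)

theorem mk_gaussCone_injective {c c' : k} {t u : ℝ} (ht : 0 < t) (hu : 0 < u)
    (h : ProjLine.mk (gaussCone k c t ht) = ProjLine.mk (gaussCone k c' u hu)) : t = u :=
  radius_eq_of_isEta ht hu ((isEta_iff c ht _).2 h.symm)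

/-! ### Lengths -/

/-- The function is proportional to `t` while `C * t ≤ D` and to `1 / t` afterwards. Injectivity
forbids the turning point `D / C` from being interior to the interval, and each of the two regimes
preserves the ratio of the endpoints, up to exchanging them. -/
theorem ratio_eq_of_bijOn {δ C D m M r s : ℝ} (hδ : 0 < δ) (hC : 0 ≤ C) (hm : 0 < m)
    (hmM : m ≤ M) (hrs : r ≤ s) (hpos : 0 < max (C * m) D)
    (h : Set.BijOn (fun t => δ * t / max (C * t) D ^ 2) (Set.Icc m M) (Set.Icc r s)) :
    s / r = M / m := by
  have hM : 0 < M := hm.trans_le hmM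
  set f : ℝ → ℝ := fun t => δ * t / max (C * t) D ^ 2 with hf
  have hrI : r ∈ Set.Icc r s := ⟨le_rfl, hrs⟩
  have hsI : s ∈ Set.Icc r s := ⟨hrs, le_rfl⟩
  have hmI : m ∈ Set.Icc m M := ⟨le_rfl, hmM⟩
  have hMI : M ∈ Set.Icc m M := ⟨hmM, le_rfl⟩
  have hfm := h.mapsTo hmI
  have hfM := h.mapsTo hMI
  obtain ⟨tr, htr, hfr⟩ := h.surjOn hrI
  obtain ⟨ts, hts, hfs⟩ := h.surjOn hsI
  have htr0 : 0 < tr := hm.trans_le htr.1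
  have hts0 : 0 < ts := hm.trans_le hts.1
  rcases le_or_gt (C * M) D with h1 | h1
  · have hD0 : 0 < D := by
      refine hpos.trans_le (max_le ?_ le_rfl)
      exact (mul_le_mul_of_nonneg_left hmM hC).trans h1
    have e : ∀ t ∈ Set.Icc m M, f t = δ / D ^ 2 * t := fun t ht => by
      rw [hf]
      simp only
      rw [max_eq_right ((mul_le_mul_of_nonneg_left ht.2 hC).trans h1)]
      ring
    have hA : 0 < δ / D ^ 2 := by positivity
    have er : r = f m := le_antisymm hfm.1 (by
      rw [← hfr, e _ hmI, e _ htr]; exact mul_le_mul_of_nonneg_left htr.1 hA.le)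
    have es : s = f M := le_antisymm (by
      rw [← hfs, e _ hMI, e _ hts]; exact mul_le_mul_of_nonneg_left hts.2 hA.le) hfM.2
    rw [er, es, e _ hmI, e _ hMI]
    field_simp
  · rcases le_or_gt D (C * m) with h2 | h2
    · have hC0 : 0 < C := by
        have : 0 < C * m := by rwa [max_eq_left h2] at hpos
        exact pos_of_mul_pos_left this hm.le
      have e : ∀ t ∈ Set.Icc m M, f t = δ / C ^ 2 / t := fun t ht => by
        have ht0 : 0 < t := hm.trans_le ht.1
        rw [hf]
        simp only
        rw [max_eq_left (h2.trans (mul_le_mul_of_nonneg_left ht.1 hC))]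
        field_simp
      have hA : 0 < δ / C ^ 2 := by positivity
      have er : r = f M := le_antisymm hfM.1 (by
        rw [← hfr, e _ hMI, e _ htr]; exact div_le_div_of_nonneg_left hA.le htr0 htr.2)
      have es : s = f m := le_antisymm (by
        rw [← hfs, e _ hmI, e _ hts]; exact div_le_div_of_nonneg_left hA.le hm hts.1) hfm.2
      rw [er, es, e _ hmI, e _ hMI]
      field_simp
    · exfalso
      have hC0 : 0 < C := by
        rcases hC.eq_or_lt with rfl | h0
        · rw [zero_mul] at h1 h2
          exact absurd h1 h2.not_gt
        · exact h0
      have hD0 : 0 < D := (mul_pos hC0 hm).trans h2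
      -- The largest `l` for which both `(D / C) * l` and `(D / C) / l` stay in `[m, M]`. The
      -- function takes the same value at these two points.
      set l := min (M * C / D) (D / (C * m)) with hl
      have hl1 : 1 < l := by
        refine lt_min ?_ ?_
        · rw [one_lt_div hD0]; linarith
        · rwa [one_lt_div (by positivity)]
      have hlM : D / C * l ≤ M := by
        calc D / C * l ≤ D / C * (M * C / D) :=
              mul_le_mul_of_nonneg_left (min_le_left _ _) (by positivity)
          _ = M := by field_simp
      have hlm : m ≤ D / C / l := by
        rw [le_div_iff₀ (by positivity)]
        calc m * l ≤ m * (D / (C * m)) :=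
              mul_le_mul_of_nonneg_left (min_le_right _ _) hm.le
          _ = D / C := by field_simp
      have hτ : 0 < D / C := by positivity
      have hup : D / C ≤ D / C * l := le_mul_of_one_le_right hτ.le hl1.le
      have hdn : D / C / l ≤ D / C := div_le_self hτ.le hl1.le
      have i1 : D / C * l ∈ Set.Icc m M := ⟨(hlm.trans hdn).trans hup, hlM⟩
      have i2 : D / C / l ∈ Set.Icc m M := ⟨hlm, (hdn.trans hup).trans hlM⟩
      have heq : f (D / C * l) = f (D / C / l) := by
        rw [hf]
        simp only
        have a1 : C * (D / C * l) = D * l := by field_simp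
        have a2 : C * (D / C / l) = D / l := by field_simp
        rw [a1, a2, max_eq_left (le_mul_of_one_le_right hD0.le hl1.le),
          max_eq_right (div_le_self hD0.le hl1.le)]
        field_simp
      have := h.injOn i1 i2 heq
      have h3 : D / C / l < D / C := div_lt_self hτ hl1
      linarith

/-- The set of the points `η_{0,t}` for `m ≤ t ≤ M`. -/
def gaussSegment (k : Type u) [NormedField k] (m M : ℝ) : Set (ProjLine k) :=
  {x | ∃ t ∈ Set.Icc m M, IsEta (0 : k) t x}

/-- This is the independence of the length from all choices. Two descriptions of the segment differ
by `g' = g⁻¹ * h`, and `imageRadius g'` must match the radii of one with those of the other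
bijectively. -/
theorem hasLength_smul_gaussSegment_iff (h : GL (Fin 2) k) {m M : ℝ} (hm : 0 < m) (hmM : m ≤ M)
    (L : ℝ) : HasLength (h • gaussSegment k m M) L ↔ L = M / m := by
  constructor
  swap
  · rintro rfl
    exact ⟨k, inferInstance, inferInstance, inferInstance, Matrix.ProjGenLinGroup.mk h, 0, m, M,
      hm, hmM, rfl, rfl⟩
  rintro ⟨k', _, _, _, g, a, r, s, hr, hrs, hS, rfl⟩
  obtain ⟨g, rfl⟩ := Matrix.ProjGenLinGroup.mk_surjective g
  rw [pgl_mk_smul_set, ← inv_smul_eq_iff, smul_smul] at hS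
  set g' := g⁻¹ * h with hg'
  refine ratio_eq_of_bijOn (norm_det_pos g') (norm_nonneg (g'.1 1 0)) hm hmM
    hrs (max_bottom_pos g' hm) ?_
  change Set.BijOn (imageRadius g') _ _
  have key : ∀ t (ht : 0 < t) v (hv : 0 < v),
      IsEta a v (g' • ProjLine.mk (gaussCone k (0 : k) t ht)) → v = imageRadius g' t := by
    intro t ht v hv h1
    obtain ⟨c, hc⟩ := exists_smul_mk_gaussCone g' ht
    rw [hc] at h1
    exact radius_eq_of_isEta hv _ h1
  have pos : ∀ t ∈ Set.Icc m M, 0 < t := fun t ht => hm.trans_le ht.1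
  have mem : ∀ t (ht : t ∈ Set.Icc m M), ∃ v ∈ Set.Icc r s,
      IsEta a v (g' • ProjLine.mk (gaussCone k (0 : k) t (pos t ht))) := by
    intro t ht
    have : g' • ProjLine.mk (gaussCone k (0 : k) t (pos t ht)) ∈ g' • gaussSegment k m M :=
      Set.smul_mem_smul_set ⟨t, ht, isEta_gaussCone _ _⟩
    rw [hS] at this
    exact this
  refine ⟨?_, ?_, ?_⟩
  · intro t ht
    obtain ⟨v, hv, h1⟩ := mem t ht
    rw [← key t (pos t ht) v (hr.trans_le hv.1) h1]
    exact hv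
  · intro t ht t' ht' htt'
    obtain ⟨v, hv, h1⟩ := mem t ht
    obtain ⟨v', hv', h1'⟩ := mem t' ht'
    -- Equal image radii give the same point `η_{a,v}`, hence the same Gauss point before applying
    -- `g'`.
    have e : v = v' := by
      rw [key t (pos t ht) v (hr.trans_le hv.1) h1, key t' (pos t' ht') v' (hr.trans_le hv'.1) h1']
      exact htt'
    subst e
    rw [isEta_iff a (hr.trans_le hv.1)] at h1 h1'
    exact mk_gaussCone_injective _ _ (smul_left_cancel g' (h1.trans h1'.symm))
  · intro v hv
    have hv0 := hr.trans_le hv.1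
    have : ProjLine.mk (gaussCone k a v hv0) ∈ g' • gaussSegment k m M := by
      rw [hS]
      exact ⟨v, hv, isEta_gaussCone a hv0⟩
    obtain ⟨x, ⟨t, ht, hx⟩, hx'⟩ := this
    rw [isEta_iff _ (pos t ht)] at hx
    subst hx
    refine ⟨t, ht, (key t (pos t ht) v hv0 ?_).symm⟩
    have hx'' : g' • ProjLine.mk (gaussCone k (0 : k) t (pos t ht)) =
      ProjLine.mk (gaussCone k a v hv0) := hx'
    rw [hx'']
    exact isEta_gaussCone a hv0

end

/-! ### Discs in arbitrary coordinates -/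

section

variable {k : Type u} [NormedField k]

/-- The open disc `{|Z| < ρ}` for a coordinate `Z` with a zero at `p` and a pole at `q`. -/
def openDiscAt (p q : Fin 2 → k) (ρ : ℝ) : Set (ProjLine k) :=
  ProjLine.mk '' {y | absForm p y < ρ * absForm q y}

/-- The closed disc `{|Z| ≤ ρ}` for a coordinate `Z` with a zero at `p` and a pole at `q`. -/
def closedDiscAt (p q : Fin 2 → k) (ρ : ℝ) : Set (ProjLine k) :=
  ProjLine.mk '' {y | absForm p y ≤ ρ * absForm q y}

theorem exists_absForm_eq_of_mk_eq {y z : ConePoint k} (h : ProjLine.mk y = ProjLine.mk z) :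
    ∃ C : ℝ, 0 < C ∧ ∀ w, absForm w y = C * absForm w z := by
  obtain ⟨C, hC, h⟩ := ProjLine.mk_eq_iff.1 h
  exact ⟨C, hC, fun w => by simpa [absForm] using h 1 _ (form_isHomogeneous w)⟩

theorem mk_mem_openDiscAt {p q : Fin 2 → k} {ρ : ℝ} {y : ConePoint k} :
    ProjLine.mk y ∈ openDiscAt p q ρ ↔ absForm p y < ρ * absForm q y := by
  refine ⟨?_, fun h => ⟨y, h, rfl⟩⟩
  rintro ⟨z, hz, hzy⟩
  obtain ⟨C, hC, h⟩ := exists_absForm_eq_of_mk_eq hzy.symm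
  rw [h, h, mul_left_comm]
  exact mul_lt_mul_of_pos_left hz hC

theorem mk_mem_closedDiscAt {p q : Fin 2 → k} {ρ : ℝ} {y : ConePoint k} :
    ProjLine.mk y ∈ closedDiscAt p q ρ ↔ absForm p y ≤ ρ * absForm q y := by
  refine ⟨?_, fun h => ⟨y, h, rfl⟩⟩
  rintro ⟨z, hz, hzy⟩
  obtain ⟨C, hC, h⟩ := exists_absForm_eq_of_mk_eq hzy.symm
  rw [h, h, mul_left_comm]
  exact mul_le_mul_of_nonneg_left hz hC.le

theorem ratPoint_mem_openDiscAt {p q : Fin 2 → k} {ρ : ℝ}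
    {a : Projectivization k (Fin 2 → k)} :
    ratPoint a ∈ openDiscAt p q ρ ↔ ‖bracket a.rep p‖ < ρ * ‖bracket a.rep q‖ := by
  rw [ratPoint, mk_mem_openDiscAt, absForm_ofVec, absForm_ofVec]

theorem ratPoint_mem_closedDiscAt {p q : Fin 2 → k} {ρ : ℝ}
    {a : Projectivization k (Fin 2 → k)} :
    ratPoint a ∈ closedDiscAt p q ρ ↔ ‖bracket a.rep p‖ ≤ ρ * ‖bracket a.rep q‖ := by
  rw [ratPoint, mk_mem_closedDiscAt, absForm_ofVec, absForm_ofVec]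

theorem openDiscAt_subset_closedDiscAt (p q : Fin 2 → k) (ρ : ℝ) :
    openDiscAt p q ρ ⊆ closedDiscAt p q ρ := by
  rintro _ ⟨y, hy, rfl⟩
  have hy' : absForm p y < ρ * absForm q y := hy
  exact ⟨y, hy'.le, rfl⟩

theorem openDiscAt_mono (p q : Fin 2 → k) {ρ ρ' : ℝ} (h : ρ ≤ ρ') :
    openDiscAt p q ρ ⊆ openDiscAt p q ρ' :=
  Set.image_mono fun y hy => lt_of_lt_of_le hy
    (mul_le_mul_of_nonneg_right h (absForm_nonneg q y))

/-- Passing to the complement replaces the coordinate `Z` by `1 / Z`. Closed discs are thereby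
reduced to open ones. -/
theorem compl_closedDiscAt (p q : Fin 2 → k) {ρ : ℝ} (hρ : 0 < ρ) :
    (closedDiscAt p q ρ)ᶜ = openDiscAt q p ρ⁻¹ := by
  ext x
  induction x using ProjLine.ind with
  | h y =>
    rw [Set.mem_compl_iff, mk_mem_closedDiscAt, mk_mem_openDiscAt, not_le, lt_inv_mul_iff₀ hρ]

theorem compl_openDiscAt (p q : Fin 2 → k) {ρ : ℝ} (hρ : 0 < ρ) :
    (openDiscAt p q ρ)ᶜ = closedDiscAt q p ρ⁻¹ := by
  rw [← compl_compl (closedDiscAt q p ρ⁻¹), compl_closedDiscAt _ _ (inv_pos.2 hρ), inv_inv]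

theorem smul_openDiscAt (g : GL (Fin 2) k) (p q : Fin 2 → k) (ρ : ℝ) :
    g • openDiscAt p q ρ = openDiscAt (g.1.mulVec p) (g.1.mulVec q) ρ := by
  ext x
  obtain ⟨x, rfl⟩ := MulAction.surjective g x
  induction x using ProjLine.ind with
  | h y =>
    change g • ProjLine.mk y ∈ _ ↔ g • ProjLine.mk y ∈ _
    rw [Set.smul_mem_smul_set_iff, smul_mk, mk_mem_openDiscAt, mk_mem_openDiscAt,
      absForm_mulVec, absForm_mulVec,
      mul_left_comm, mul_lt_mul_iff_right₀ (norm_det_pos g)]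

theorem openDiscAt_smul_smul (p q : Fin 2 → k) {b c : k} (hb : b ≠ 0) (ρ : ℝ) :
    openDiscAt (b • p) (c • q) ρ = openDiscAt p q (ρ * ‖c‖ / ‖b‖) := by
  ext x
  induction x using ProjLine.ind with
  | h y =>
    rw [mk_mem_openDiscAt, mk_mem_openDiscAt, absForm_smul, absForm_smul, div_mul_eq_mul_div,
      lt_div_iff₀' (norm_pos_iff.2 hb), mul_assoc]

theorem openDisc_eq (a : k) (r : ℝ) : openDisc a r = openDiscAt ![a, 1] ![1, 0] r := by
  simp only [openDisc, openDiscAt, seminorm_X_sub, seminorm_X_one]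

theorem closedDisc_eq (a : k) (r : ℝ) : closedDisc a r = closedDiscAt ![a, 1] ![1, 0] r := by
  simp only [closedDisc, closedDiscAt, seminorm_X_sub, seminorm_X_one]

theorem openDiscAt_eq_frame_smul {p q : Fin 2 → k} (h : bracket p q ≠ 0) (ρ : ℝ) :
    openDiscAt p q ρ = frame p q h • openDisc (0 : k) ρ := by
  rw [openDisc_eq, smul_openDiscAt, frame_mulVec_zero, frame_mulVec_infty]

theorem isOpenDisc_iff {E : Set (ProjLine k)} :
    IsOpenDisc E ↔ ∃ (p q : Fin 2 → k) (ρ : ℝ), bracket p q ≠ 0 ∧ 0 < ρ ∧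
      E = openDiscAt p q ρ := by
  constructor
  · rintro ⟨g, a, r, hr, rfl⟩
    obtain ⟨g, rfl⟩ := Matrix.ProjGenLinGroup.mk_surjective g
    refine ⟨g.1.mulVec ![a, 1], g.1.mulVec ![1, 0], r, ?_, hr, ?_⟩
    swap
    · rw [pgl_mk_smul_set, openDisc_eq, smul_openDiscAt]
    · rw [bracket_mulVec]
      refine mul_ne_zero (norm_pos_iff.1 (norm_det_pos g)) ?_
      simp [bracket]
  · rintro ⟨p, q, ρ, h, hρ, rfl⟩
    exact ⟨Matrix.ProjGenLinGroup.mk (frame p q h), 0, ρ, hρ, openDiscAt_eq_frame_smul h ρ⟩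

theorem isOpenDisc_openDiscAt {p q : Fin 2 → k} (h : bracket p q ≠ 0) {ρ : ℝ} (hρ : 0 < ρ) :
    IsOpenDisc (openDiscAt p q ρ) :=
  isOpenDisc_iff.2 ⟨p, q, ρ, h, hρ, rfl⟩

theorem isOpenDisc_compl_iff {E : Set (ProjLine k)} : IsOpenDisc Eᶜ ↔ IsClosedDisc E := by
  constructor
  · intro h
    obtain ⟨p, q, ρ, h, hρ, hE⟩ := isOpenDisc_iff.1 h
    rw [compl_eq_comm, compl_openDiscAt _ _ hρ] at hE
    have h' : bracket q p ≠ 0 := by rwa [bracket_swap, neg_ne_zero]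
    refine ⟨Matrix.ProjGenLinGroup.mk (frame q p h'), 0, ρ⁻¹, inv_pos.2 hρ, ?_⟩
    rw [pgl_mk_smul_set, closedDisc_eq, ← compl_openDiscAt _ _ hρ, Set.smul_set_compl,
      smul_openDiscAt, frame_mulVec_zero, frame_mulVec_infty, compl_openDiscAt _ _ hρ, hE]
  · rintro ⟨g, a, r, hr, rfl⟩
    obtain ⟨g, rfl⟩ := Matrix.ProjGenLinGroup.mk_surjective g
    rw [pgl_mk_smul_set, ← Set.smul_set_compl, closedDisc_eq, compl_closedDiscAt _ _ hr,
      smul_openDiscAt]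
    refine isOpenDisc_openDiscAt ?_ (inv_pos.2 hr)
    rw [bracket_mulVec]
    refine mul_ne_zero (norm_pos_iff.1 (norm_det_pos g)) ?_
    simp [bracket]

theorem isClosedDisc_closedDiscAt {p q : Fin 2 → k} (h : bracket p q ≠ 0) {ρ : ℝ} (hρ : 0 < ρ) :
    IsClosedDisc (closedDiscAt p q ρ) := by
  rw [← isOpenDisc_compl_iff, compl_closedDiscAt _ _ hρ]
  exact isOpenDisc_openDiscAt (by rwa [bracket_swap, neg_ne_zero]) (inv_pos.2 hρ)

/-! ### Loxodromic transformations -/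

/-- The product of the two matrices is scalar, hence trivial in `PGL₂(k)`. -/
theorem koebe_swap (α α' : Projectivization k (Fin 2 → k)) (β : k) (h : α ≠ α') (hβ : 0 < ‖β‖) :
    koebe α' α β h.symm hβ = (koebe α α' β h hβ)⁻¹ := by
  have hc : -(β * pairing α α' ^ 2) ≠ 0 :=
    neg_ne_zero.2 (mul_ne_zero (norm_pos_iff.1 hβ) (pow_ne_zero 2 (pairing_ne_zero h)))
  rw [eq_inv_iff_mul_eq_one, koebe, koebe, ← map_mul,
    ← Matrix.ProjGenLinGroup.mk_scalar (Units.mk0 _ hc)]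
  congr 1
  apply Units.ext
  change koebeMatrix α' α β * koebeMatrix α α' β = Matrix.scalar (Fin 2) (-(β * pairing α α' ^ 2))
  ext i j
  fin_cases i <;> fin_cases j <;>
    simp [koebeMatrix, pairing, Matrix.mul_apply, Fin.sum_univ_two] <;> ring

/-- Representatives of the two fixed points are eigenvectors whose eigenvalues have quotient `β`, so
the transformation is `Z ↦ β * Z`. -/
theorem koebe_smul_openDiscAt {α α' : Projectivization k (Fin 2 → k)} {β : k} (h : α ≠ α')
    (hβ : 0 < ‖β‖) (ρ : ℝ) :
    koebe α α' β h hβ • openDiscAt α.rep α'.rep ρ = openDiscAt α.rep α'.rep (‖β‖ * ρ) := by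
  have hP := pairing_ne_zero h
  have hb := norm_pos_iff.1 hβ
  have h1 : (koebeMatrix α α' β).mulVec α.rep = pairing α α' • α.rep := by
    ext i
    fin_cases i <;>
      simp [koebeMatrix, Matrix.mulVec, dotProduct, Fin.sum_univ_two, pairing] <;> ring
  have h2 : (koebeMatrix α α' β).mulVec α'.rep = (β * pairing α α') • α'.rep := by
    ext i
    fin_cases i <;>
      simp [koebeMatrix, Matrix.mulVec, dotProduct, Fin.sum_univ_two, pairing] <;> ring
  rw [koebe, pgl_mk_smul_set, smul_openDiscAt]
  change openDiscAt ((koebeMatrix α α' β).mulVec α.rep) ((koebeMatrix α α' β).mulVec α'.rep) ρ = _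
  rw [h1, h2, openDiscAt_smul_smul _ _ hP]
  congr 1
  have := norm_pos_iff.2 hP
  rw [norm_mul]
  field_simp

theorem koebe_smul_openDiscAt_swap {α α' : Projectivization k (Fin 2 → k)} {β : k} (h : α ≠ α')
    (hβ : 0 < ‖β‖) (ρ : ℝ) :
    koebe α α' β h hβ • openDiscAt α'.rep α.rep ρ = openDiscAt α'.rep α.rep (ρ / ‖β‖) := by
  rw [← inv_inv (koebe α α' β h hβ), ← koebe_swap, inv_smul_eq_iff, koebe_smul_openDiscAt]
  congr 1
  field_simp

theorem koebe_smul_closedDiscAt {α α' : Projectivization k (Fin 2 → k)} {β : k} (h : α ≠ α')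
    (hβ : 0 < ‖β‖) {ρ : ℝ} (hρ : 0 < ρ) :
    koebe α α' β h hβ • closedDiscAt α.rep α'.rep ρ = closedDiscAt α.rep α'.rep (‖β‖ * ρ) := by
  have h1 := compl_openDiscAt α'.rep α.rep (inv_pos.2 hρ)
  rw [inv_inv] at h1
  rw [← h1, Set.smul_set_compl, koebe_smul_openDiscAt_swap,
    compl_openDiscAt _ _ (div_pos (inv_pos.2 hρ) hβ)]
  congr 1
  field_simp

theorem koebe_smul_closedDiscAt_swap {α α' : Projectivization k (Fin 2 → k)} {β : k} (h : α ≠ α')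
    (hβ : 0 < ‖β‖) {ρ : ℝ} (hρ : 0 < ρ) :
    koebe α α' β h hβ • (closedDiscAt α'.rep α.rep ρ)ᶜ = openDiscAt α.rep α'.rep (‖β‖ / ρ) := by
  rw [compl_closedDiscAt _ _ hρ, koebe_smul_openDiscAt, div_eq_mul_inv]

theorem exists_ratPoint_notMem {U : Set (ProjLine k)} (hU : IsOpenDisc U) :
    ∃ q : Projectivization k (Fin 2 → k), ratPoint q ∉ U := by
  obtain ⟨p, q, ρ, hpq, -, rfl⟩ := isOpenDisc_iff.1 hU
  have hq := right_ne_zero_of_bracket hpq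
  refine ⟨Projectivization.mk k q hq, ?_⟩
  rw [ratPoint_mem_openDiscAt]
  obtain ⟨c, hc⟩ := Projectivization.exists_smul_eq_mk_rep k q hq
  have : bracket (Projectivization.mk k q hq).rep q = 0 := by
    rw [← hc]
    simp only [bracket, Pi.smul_apply, Units.smul_def, smul_eq_mul]
    ring
  rw [this, norm_zero, mul_zero]
  exact (norm_nonneg _).not_gt

end

/-! ### Centers, radii and disjointness of discs in the ultrametric setting. -/

section

variable {k : Type u} [NormedField k] [IsUltrametricDist k]

theorem absForm_add_eq_of_lt {w w' : Fin 2 → k} {y : ConePoint k}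
    (h : absForm w' y < absForm w y) : absForm (w + w') y = absForm w y := by
  apply le_antisymm
  · exact (absForm_add_le _ _ _).trans (max_le le_rfl h.le)
  · have h1 := absForm_add_le (w + w') ((-1 : k) • w') y
    have h2 : w + w' + (-1 : k) • w' = w := by simp
    rw [h2, absForm_smul, norm_neg, norm_one, one_mul] at h1
    rcases le_max_iff.1 h1 with h1 | h1
    · exact h1
    · exact absurd h1 h.not_ge

/-- The new coordinate is `Z + e`: the zero moves inside the disc. -/
theorem openDiscAt_add_left (p q : Fin 2 → k) {ρ : ℝ} {e : k} (he : ‖e‖ < ρ) :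
    openDiscAt (p + e • q) q ρ = openDiscAt p q ρ := by
  have key : ∀ (p : Fin 2 → k) (e : k), ‖e‖ < ρ → openDiscAt p q ρ ⊆
      openDiscAt (p + e • q) q ρ := by
    intro p e he x
    induction x using ProjLine.ind with
    | h y =>
      rw [mk_mem_openDiscAt, mk_mem_openDiscAt]
      intro h
      refine (absForm_add_le _ _ _).trans_lt (max_lt h ?_)
      rw [absForm_smul]
      refine mul_lt_mul_of_pos_right he ?_
      refine (absForm_nonneg _ _).lt_of_ne fun h0 => ?_
      rw [← h0, mul_zero] at h
      exact h.not_ge (absForm_nonneg _ _)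
  refine Set.Subset.antisymm ?_ (key p e he)
  have := key (p + e • q) (-e) (by rwa [norm_neg])
  rwa [add_assoc, ← add_smul, add_neg_cancel, zero_smul, add_zero] at this

/-- The new coordinate is `Z / (1 + f * Z)`, and `|f * Z| < 1` on the disc: the pole moves outside
the disc. -/
theorem openDiscAt_add_right (p q : Fin 2 → k) {ρ : ℝ} (hρ : 0 < ρ) {f : k} (hf : ‖f‖ ≤ ρ⁻¹) :
    openDiscAt p (q + f • p) ρ = openDiscAt p q ρ := by
  have key : ∀ (q : Fin 2 → k) (f : k), ‖f‖ ≤ ρ⁻¹ → openDiscAt p q ρ ⊆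
      openDiscAt p (q + f • p) ρ := by
    intro q f hf x
    induction x using ProjLine.ind with
    | h y =>
      rw [mk_mem_openDiscAt, mk_mem_openDiscAt]
      intro h
      rw [absForm_add_eq_of_lt]
      · exact h
      · rw [absForm_smul]
        refine (mul_le_mul_of_nonneg_right hf (absForm_nonneg _ _)).trans_lt ?_
        rwa [inv_mul_lt_iff₀ hρ]
  refine Set.Subset.antisymm ?_ (key q f hf)
  have := key (q + f • p) (-f) (by rwa [norm_neg])
  rwa [add_assoc, ← add_smul, add_neg_cancel, zero_smul, add_zero] at this

/-- Any rational point of an open disc is a center of it, and any rational point of the complement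
is a center of the complement. -/
theorem IsOpenDisc.exists_eq {E : Set (ProjLine k)} (hE : IsOpenDisc E)
    {a b : Projectivization k (Fin 2 → k)} (ha : ratPoint a ∈ E) (hb : ratPoint b ∉ E) :
    ∃ ρ : ℝ, 0 < ρ ∧ E = openDiscAt a.rep b.rep ρ := by
  obtain ⟨p, q, ρ, hpq, hρ, rfl⟩ := isOpenDisc_iff.1 hE
  rw [ratPoint_mem_openDiscAt] at ha
  have hq : bracket a.rep q ≠ 0 := by
    intro h
    rw [h, norm_zero, mul_zero] at ha
    exact ha.not_ge (norm_nonneg _)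
  -- The translation that moves the zero of the coordinate to `a`. The bound `‖e‖ < ρ` says exactly
  -- that `a` lies in the disc.
  set e := -(bracket a.rep p / bracket a.rep q) with he
  have hne : ‖e‖ < ρ := by
    rwa [he, norm_neg, norm_div, div_lt_iff₀ (norm_pos_iff.2 hq)]
  have h1 : bracket a.rep (p + e • q) = 0 := by
    have : bracket a.rep (p + e • q) = bracket a.rep p + e * bracket a.rep q := by
      simp only [bracket, Pi.add_apply, Pi.smul_apply, smul_eq_mul]; ring
    rw [this, he]
    field_simp
    ring
  have hbr : bracket (p + e • q) q = bracket p q := by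
    simp only [bracket, Pi.add_apply, Pi.smul_apply, smul_eq_mul]; ring
  obtain ⟨c, hc⟩ := exists_smul_of_bracket_eq_zero a.rep_nonzero h1
  rw [← openDiscAt_add_left p q hne] at hb ⊢
  rw [← hbr] at hpq
  set p' := p + e • q
  rw [ratPoint_mem_openDiscAt, not_lt] at hb
  have hp' : bracket b.rep p' ≠ 0 := by
    intro h
    rw [h, norm_zero] at hb
    have hb2 : bracket b.rep q = 0 := by
      by_contra h2
      exact hb.not_gt (mul_pos hρ (norm_pos_iff.2 h2))
    obtain ⟨c1, h3⟩ := exists_smul_of_bracket_eq_zero b.rep_nonzero h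
    obtain ⟨c2, h4⟩ := exists_smul_of_bracket_eq_zero b.rep_nonzero hb2
    apply hpq
    rw [h3, h4]
    simp only [bracket, Pi.smul_apply, smul_eq_mul]
    ring
  -- Likewise for moving the pole to `b`: the bound `‖f‖ ≤ ρ⁻¹` says that `b` lies outside the disc.
  set f := -(bracket b.rep q / bracket b.rep p') with hf
  have hnf : ‖f‖ ≤ ρ⁻¹ := by
    rw [hf, norm_neg, norm_div, div_le_iff₀ (norm_pos_iff.2 hp'), le_inv_mul_iff₀ hρ]
    exact hb
  have h2 : bracket b.rep (q + f • p') = 0 := by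
    have : bracket b.rep (q + f • p') = bracket b.rep q + f * bracket b.rep p' := by
      simp only [bracket, Pi.add_apply, Pi.smul_apply, smul_eq_mul]; ring
    rw [this, hf]
    field_simp
    ring
  have hbr2 : bracket p' (q + f • p') = bracket p' q := by
    simp only [bracket, Pi.add_apply, Pi.smul_apply, smul_eq_mul]; ring
  obtain ⟨d, hd⟩ := exists_smul_of_bracket_eq_zero b.rep_nonzero h2
  rw [← openDiscAt_add_right p' q hρ hnf]
  rw [← hbr2, hd, hc] at hpq
  have hc0 : c ≠ 0 := by
    rintro rfl
    simp [bracket] at hpq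
  have hd0 : d ≠ 0 := by
    rintro rfl
    simp [bracket] at hpq
  rw [hd, hc, openDiscAt_smul_smul _ _ hc0]
  have := norm_pos_iff.2 hc0
  have := norm_pos_iff.2 hd0
  exact ⟨_, by positivity, rfl⟩

theorem IsClosedDisc.exists_eq {E : Set (ProjLine k)} (hE : IsClosedDisc E)
    {a b : Projectivization k (Fin 2 → k)} (ha : ratPoint a ∈ E) (hb : ratPoint b ∉ E) :
    ∃ ρ : ℝ, 0 < ρ ∧ E = closedDiscAt a.rep b.rep ρ := by
  obtain ⟨ρ, hρ, h⟩ := (isOpenDisc_compl_iff.2 hE).exists_eq (a := b) (b := a) hb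
    (fun h => h ha)
  refine ⟨ρ⁻¹, inv_pos.2 hρ, ?_⟩
  rw [← compl_compl E, h, compl_openDiscAt _ _ hρ]

/-- Rational points only realize radii in the value group. Gauss points realize every positive real,
which is why inclusions of concentric discs force inequalities between radii. -/
theorem exists_absForm_eq {p q : Fin 2 → k} (h : bracket p q ≠ 0) {t : ℝ} (ht : 0 < t) :
    ∃ y : ConePoint k, absForm p y = t * absForm q y ∧ 0 < absForm q y := by
  refine ⟨frame p q h • gaussCone k (0 : k) t ht, ?_⟩
  have h1 := absForm_mulVec (frame p q h) ![0, 1] (gaussCone k (0 : k) t ht)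
  have h2 := absForm_mulVec (frame p q h) ![1, 0] (gaussCone k (0 : k) t ht)
  have hd := norm_det_pos (frame p q h)
  rw [frame_mulVec_zero, absForm_gaussCone] at h1
  rw [frame_mulVec_infty, absForm_gaussCone] at h2
  have h3 : max t 0 = t := max_eq_left ht.le
  simp only [Matrix.cons_val_zero, Matrix.cons_val_one, norm_one, one_mul, norm_zero, zero_mul,
    mul_zero, sub_zero, zero_sub, norm_neg, h3, max_eq_right zero_le_one, mul_one] at h1 h2
  rw [h1, h2]
  exact ⟨mul_comm _ _, hd⟩

theorem le_of_openDiscAt_subset_closedDiscAt {p q : Fin 2 → k} (h : bracket p q ≠ 0) {r s : ℝ}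
    (hs : 0 < s) (hsub : openDiscAt p q r ⊆ closedDiscAt p q s) : r ≤ s := by
  by_contra! hlt
  obtain ⟨t, hst, htr⟩ := exists_between hlt
  obtain ⟨y, hy, hq⟩ := exists_absForm_eq h (hs.trans hst)
  have h1 : ProjLine.mk y ∈ openDiscAt p q r := by
    rw [mk_mem_openDiscAt, hy]
    exact mul_lt_mul_of_pos_right htr hq
  have h2 := mk_mem_closedDiscAt.1 (hsub h1)
  rw [hy] at h2
  exact h2.not_gt (mul_lt_mul_of_pos_right hst hq)

theorem le_of_openDiscAt_subset {p q : Fin 2 → k} (h : bracket p q ≠ 0) {r s : ℝ}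
    (hs : 0 < s) (hsub : openDiscAt p q r ⊆ openDiscAt p q s) : r ≤ s :=
  le_of_openDiscAt_subset_closedDiscAt h hs (hsub.trans (openDiscAt_subset_closedDiscAt p q s))

/-- Two closed discs, each with a rational point outside the other one, are disjoint as soon as
some rational point lies in neither of them. -/
theorem IsClosedDisc.disjoint {B B' : Set (ProjLine k)} (hB : IsClosedDisc B)
    (hB' : IsClosedDisc B') {a a' c : Projectivization k (Fin 2 → k)} (ha : ratPoint a ∈ B)
    (ha' : ratPoint a' ∈ B') (haB' : ratPoint a ∉ B') (ha'B : ratPoint a' ∉ B)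
    (hc : ratPoint c ∉ B) (hc' : ratPoint c ∉ B') : Disjoint B B' := by
  obtain ⟨r, hr, rfl⟩ := hB.exists_eq ha hc
  obtain ⟨r', hr', rfl⟩ := hB'.exists_eq ha' hc'
  have hac : bracket a.rep c.rep ≠ 0 :=
    bracket_rep_ne_zero fun h => hc (h ▸ ha)
  rw [Set.disjoint_left]
  intro x
  induction x using ProjLine.ind with
  | h y =>
    intro h1 h2
    rw [ratPoint_mem_closedDiscAt, not_le] at haB' ha'B
    rw [mk_mem_closedDiscAt] at h1 h2
    have hcy : 0 < absForm c.rep y := by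
      refine (absForm_nonneg _ _).lt_of_ne fun h0 => ?_
      rw [← h0, mul_zero] at h1
      rcases absForm_pos_or_pos hac y with h | h
      · exact h.not_ge h1
      · exact h.ne h0
    -- At a common point both terms on the right are strictly smaller than the left side, one
    -- because `a'` is outside the first disc and the other because `a` is outside the second.
    have key := norm_bracket_mul_absForm_le a.rep a'.rep c.rep y
    refine key.not_gt (max_lt ?_ ?_)
    · rw [norm_bracket_comm a.rep a'.rep, norm_bracket_comm a'.rep c.rep] at *
      calc _ ≤ ‖bracket a'.rep c.rep‖ * (r * absForm c.rep y) := by gcongr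
        _ = r * ‖bracket a'.rep c.rep‖ * absForm c.rep y := by ring
        _ < _ := mul_lt_mul_of_pos_right (by simpa [norm_bracket_comm] using ha'B) hcy
    · calc _ ≤ ‖bracket a.rep c.rep‖ * (r' * absForm c.rep y) := by gcongr
        _ = r' * ‖bracket a.rep c.rep‖ * absForm c.rep y := by ring
        _ < _ := mul_lt_mul_of_pos_right haB' hcy

/-- If an open disc is stable by a loxodromic transformation, then it does not contain the
repelling fixed point. -/
theorem ratPoint_notMem_of_koebe_smul_subset {α α' : Projectivization k (Fin 2 → k)} {β : k}
    (h : α ≠ α') (hβ : 0 < ‖β‖) (hβ1 : ‖β‖ < 1) {U : Set (ProjLine k)} (hU : IsOpenDisc U)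
    (hsub : koebe α α' β h hβ • U ⊆ U) : ratPoint α' ∉ U := by
  intro hα'
  by_cases hα : ratPoint α ∈ U
  · obtain ⟨q, hq⟩ := exists_ratPoint_notMem hU
    have hαq : bracket α.rep q.rep ≠ 0 := bracket_rep_ne_zero fun e => hq (e ▸ hα)
    have hα'q : bracket α'.rep q.rep ≠ 0 := bracket_rep_ne_zero fun e => hq (e ▸ hα')
    obtain ⟨ρ, hρ, hE⟩ := hU.exists_eq hα hq
    -- With both fixed points in `U`, the coordinate `Z` with zero `α` and pole `α'` has constant
    -- absolute value outside `U`, equal to `|Z(q)|`. In Cramer's rule the term in `q` is negligible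
    -- there.
    have hratio : ∀ y : ConePoint k, ProjLine.mk y ∉ U →
        ‖bracket α.rep q.rep‖ * absForm α'.rep y = ‖bracket α'.rep q.rep‖ * absForm α.rep y := by
      intro y hy
      rw [hE, mk_mem_openDiscAt, not_lt] at hy
      rw [hE, ratPoint_mem_openDiscAt] at hα'
      rw [← absForm_smul, ← absForm_smul, smul_eq_bracket_smul_add, absForm_add_eq_of_lt]
      rw [absForm_smul, absForm_smul, norm_bracket_comm α'.rep α.rep]
      rcases (absForm_nonneg q.rep y).eq_or_lt with h0 | h0
      · rw [← h0, mul_zero]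
        have := (absForm_pos_or_pos hαq y).resolve_right (h0 ▸ lt_irrefl _)
        exact mul_pos (norm_pos_iff.2 hα'q) this
      · calc _ < ρ * ‖bracket α'.rep q.rep‖ * absForm q.rep y := mul_lt_mul_of_pos_right hα' h0
          _ = ‖bracket α'.rep q.rep‖ * (ρ * absForm q.rep y) := by ring
          _ ≤ _ := by gcongr
    have p1 := norm_pos_iff.2 hαq
    have p2 := norm_pos_iff.2 hα'q
    set κ := ‖bracket α.rep q.rep‖ / ‖bracket α'.rep q.rep‖ with hκ
    have hκ0 : 0 < κ := div_pos p1 p2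
    have hV : Uᶜ ⊆ closedDiscAt α.rep α'.rep κ := by
      intro x
      induction x using ProjLine.ind with
      | h y =>
        intro hy
        rw [mk_mem_closedDiscAt, hκ, div_mul_eq_mul_div, hratio y hy]
        exact le_of_eq (by field_simp)
    -- Stability of `U` keeps the inverse image of `q` outside `U`, where `|Z| ≤ κ`. Applying the
    -- transformation gives `|Z(q)| ≤ |β| * κ`, although `|Z(q)| = κ`.
    have hqβ : ratPoint q ∈ closedDiscAt α.rep α'.rep (‖β‖ * κ) := by
      rw [← koebe_smul_closedDiscAt h hβ hκ0, Set.mem_smul_set_iff_inv_smul_mem]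
      refine hV fun hmem => hq (hsub ?_)
      rwa [Set.mem_smul_set_iff_inv_smul_mem]
    have hr := hratio _ hq
    rw [ratPoint, mk_mem_closedDiscAt] at hqβ
    set y := ConePoint.ofVec q.rep q.rep_nonzero
    have hpos : 0 < absForm α'.rep y := by
      rw [absForm_ofVec, norm_bracket_comm]
      exact p2
    have : κ * absForm α'.rep y = absForm α.rep y := by
      rw [hκ, div_mul_eq_mul_div, hr]
      field_simp
    rw [← this, mul_assoc] at hqβ
    exact hqβ.not_gt (mul_lt_of_lt_one_left (mul_pos hκ0 hpos) hβ1)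
  -- Here `U` is a disc centered at the repelling point, and the transformation enlarges its radius
  -- by the factor `1 / |β|`.
  · obtain ⟨ρ, hρ, rfl⟩ := hU.exists_eq hα' hα
    rw [koebe_smul_openDiscAt_swap] at hsub
    have h1 := le_of_openDiscAt_subset (bracket_rep_ne_zero h.symm) hρ hsub
    rw [div_le_iff₀ hβ] at h1
    exact h1.not_gt (mul_lt_of_lt_one_right hρ hβ1)

end

/-! ### The topology of the projective line -/

section

variable {k : Type u} [NormedField k]

theorem ConePoint.continuous_seminorm (F : MvPolynomial (Fin 2) k) :
    Continuous fun y : ConePoint k => y.seminorm F :=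
  (continuous_apply F).comp continuous_induced_dom

theorem ConePoint.continuous_iff {X : Type*} [TopologicalSpace X] {f : X → ConePoint k} :
    Continuous f ↔ ∀ F, Continuous fun x => (f x).seminorm F :=
  continuous_induced_rng.trans continuous_pi_iff

theorem ProjLine.continuous_mk : Continuous (ProjLine.mk : ConePoint k → ProjLine k) :=
  continuous_quotient_mk'

instance : ContinuousConstSMul (GL (Fin 2) k) (ConePoint k) where
  continuous_const_smul g :=
    ConePoint.continuous_iff.2 fun F => ConePoint.continuous_seminorm (subst g.1 F)

instance : ContinuousConstSMul (GL (Fin 2) k) (ProjLine k) where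
  continuous_const_smul g := by
    exact (ProjLine.continuous_mk.comp (continuous_const_smul g) :
      Continuous fun y : ConePoint k => ProjLine.mk (g • y)).quotient_lift _

theorem smul_frontier (g : GL (Fin 2) k) (S : Set (ProjLine k)) :
    g • frontier S = frontier (g • S) :=
  (Homeomorph.smul g).image_frontier S

theorem ConePoint.max_pos (y : ConePoint k) :
    0 < max (y.seminorm (MvPolynomial.X 0)) (y.seminorm (MvPolynomial.X 1)) := by
  obtain ⟨i, hi⟩ := y.exists_ne_zero
  have := (apply_nonneg y.seminorm (MvPolynomial.X i)).lt_of_ne hi.symm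
  fin_cases i
  · exact lt_max_of_lt_left this
  · exact lt_max_of_lt_right this

/-- The absolute value of a homogeneous polynomial, normalized by the coordinates. -/
def normalized {d : ℕ} {F : MvPolynomial (Fin 2) k} (hF : F.IsHomogeneous d) :
    ProjLine k → ℝ :=
  Quotient.lift (fun y : ConePoint k => y.seminorm F /
    max (y.seminorm (MvPolynomial.X 0)) (y.seminorm (MvPolynomial.X 1)) ^ d) (by
    rintro y z ⟨C, hC, h⟩
    rw [h d F hF, h 1 _ (MvPolynomial.isHomogeneous_X k 0),
      h 1 _ (MvPolynomial.isHomogeneous_X k 1), pow_one, ← mul_max_of_nonneg _ _ hC.le, mul_pow,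
      mul_div_mul_left _ _ (pow_pos hC d).ne'])

theorem normalized_mk {d : ℕ} {F : MvPolynomial (Fin 2) k} (hF : F.IsHomogeneous d)
    (y : ConePoint k) : normalized hF (ProjLine.mk y) = y.seminorm F /
      max (y.seminorm (MvPolynomial.X 0)) (y.seminorm (MvPolynomial.X 1)) ^ d := rfl

theorem continuous_normalized {d : ℕ} {F : MvPolynomial (Fin 2) k} (hF : F.IsHomogeneous d) :
    Continuous (normalized hF) := by
  refine Continuous.quotient_lift ?_ _
  refine (ConePoint.continuous_seminorm F).div ?_ fun y => (pow_pos y.max_pos d).ne'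
  exact ((ConePoint.continuous_seminorm _).max (ConePoint.continuous_seminorm _)).pow d

theorem openDiscAt_eq_setOf_normalized (p q : Fin 2 → k) (ρ : ℝ) :
    openDiscAt p q ρ = {x | normalized (form_isHomogeneous p) x <
      ρ * normalized (form_isHomogeneous q) x} := by
  ext x
  induction x using ProjLine.ind with
  | h y =>
    rw [mk_mem_openDiscAt, Set.mem_ofPred_eq, normalized_mk, normalized_mk, ← mul_div_assoc,
      div_lt_div_iff_of_pos_right (pow_pos y.max_pos 1)]
    rfl

theorem isOpen_openDiscAt (p q : Fin 2 → k) (ρ : ℝ) : IsOpen (openDiscAt p q ρ) := by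
  rw [openDiscAt_eq_setOf_normalized]
  exact isOpen_lt (continuous_normalized _) (continuous_const.mul (continuous_normalized _))

theorem isClosed_closedDiscAt (p q : Fin 2 → k) {ρ : ℝ} (hρ : 0 < ρ) :
    IsClosed (closedDiscAt p q ρ) := by
  rw [← isOpen_compl_iff, compl_closedDiscAt p q hρ]
  exact isOpen_openDiscAt _ _ _

theorem continuous_gaussNorm {K : Type*} [NormedField K] (P : Polynomial K) :
    Continuous fun t => P.gaussNorm (NormedField.toAbsoluteValue K) t := by
  by_cases h : P.support.Nonempty
  · simp only [Polynomial.gaussNorm, h, dite_true]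
    exact Continuous.finset_sup'_apply h fun i _ => continuous_const.mul (continuous_pow i)
  · simp only [Polynomial.gaussNorm, h, dite_false]
    exact continuous_const

/-- The equality determines `s ^ (j - i)`, so it has at most one positive solution. If that solution
lies in `(0, r)`, the neighborhood starts just after it. -/
theorem eventually_mul_pow_ne {b c : ℝ} (hc : 0 < c) {i j : ℕ} (hij : i < j) {r : ℝ}
    (hr : 0 < r) : ∀ᶠ s in nhdsWithin r (Set.Iio r), b * s ^ i ≠ c * s ^ j := by
  have uniq : ∀ s s' : ℝ, 0 < s → s < s' → b * s ^ i = c * s ^ j → b * s' ^ i ≠ c * s' ^ j := by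
    intro s s' hs hss' h h'
    obtain ⟨n, rfl⟩ := Nat.exists_eq_add_of_lt hij
    have hs' := hs.trans hss'
    have e : ∀ x : ℝ, 0 < x → b * x ^ i = c * x ^ (i + n + 1) → b = c * x ^ (n + 1) := by
      intro x hx h
      have hxi := pow_pos hx i
      rw [add_assoc, pow_add] at h
      nlinarith [mul_right_cancel₀ hxi.ne' (h.trans (by ring : _ = c * x ^ (n + 1) * x ^ i))]
    have h1 := (e s hs h).symm.trans (e s' hs' h')
    have h2 := pow_lt_pow_left₀ hss' hs.le (Nat.succ_ne_zero n)
    exact h2.ne (mul_left_cancel₀ hc.ne' h1)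
  by_cases hex : ∃ s ∈ Set.Ioo 0 r, b * s ^ i = c * s ^ j
  · obtain ⟨s, hs, h⟩ := hex
    filter_upwards [Ioo_mem_nhdsLT hs.2] with s' hs'
    exact uniq s s' hs.1 hs'.1 h
  · push Not at hex
    filter_upwards [Ioo_mem_nhdsLT hr] with s' hs'
    exact hex s' hs'

theorem coeff_dehomogenize_eq_zero (a : k) {d i : ℕ} {F : MvPolynomial (Fin 2) k}
    (hF : F.IsHomogeneous d) (hi : d < i) : (dehomogenize k a F).coeff i = 0 := by
  conv_lhs => rw [eq_sum_of_isHomogeneous a hF]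
  rw [map_sum, Polynomial.finsetSum_coeff]
  refine Finset.sum_eq_zero fun j hj => ?_
  have hj' := Finset.mem_range.1 hj
  rw [map_mul, map_mul, map_pow, map_pow, map_sub, map_mul, dehomogenize_C, dehomogenize_C,
    dehomogenize_X_zero, dehomogenize_X_one, one_pow, mul_one, mul_one, Algebra.algebraMap_self,
    RingHom.id_apply, RingHom.id_apply, add_sub_cancel_right, Polynomial.coeff_C_mul_X_pow,
    if_neg (by omega)]

end

/-! ### The boundary point of an open disc. -/

section

variable {k : Type u} [NormedField k] [IsUltrametricDist k]

theorem continuous_mk_gaussCone {X : Type*} [TopologicalSpace X] (a : k) {f : X → ℝ}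
    (hf : Continuous f) (hpos : ∀ x, 0 < f x) :
    Continuous fun x => ProjLine.mk (gaussCone k a (f x) (hpos x)) :=
  ProjLine.continuous_mk.comp (ConePoint.continuous_iff.2 fun _ =>
    (continuous_gaussNorm _).comp hf)

/-- Near the boundary of a disc, the absolute value of a polynomial only depends on the absolute
value of the coordinate. -/
theorem eventually_seminorm_eq {d : ℕ} {F : MvPolynomial (Fin 2) k} (hF : F.IsHomogeneous d)
    {r : ℝ} (hr : 0 < r) : ∀ᶠ s in nhdsWithin r (Set.Iio r), ∀ y : ConePoint k,
      0 < absForm ![1, 0] y → absForm ![0, 1] y = s * absForm ![1, 0] y →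
      y.seminorm F = absForm ![1, 0] y ^ d *
        (dehomogenize k (0 : k) F).gaussNorm (NormedField.toAbsoluteValue k) s := by
  set P := dehomogenize k (0 : k) F with hP
  -- Once the terms have pairwise distinct absolute values, the largest one is unique and the
  -- ultrametric inequality becomes an equality.
  have h1 : ∀ᶠ s in nhdsWithin r (Set.Iio r), ∀ i ∈ P.support, ∀ j ∈ P.support, i < j →
      ‖P.coeff i‖ * s ^ i ≠ ‖P.coeff j‖ * s ^ j := by
    rw [Filter.eventually_all_finset]
    intro i hi
    rw [Filter.eventually_all_finset]
    intro j hj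
    by_cases hij : i < j
    · filter_upwards [eventually_mul_pow_ne (b := ‖P.coeff i‖)
        (norm_pos_iff.2 (Polynomial.mem_support_iff.1 hj)) hij hr] with s hs _
      exact hs
    · exact Filter.Eventually.of_forall fun s h => absurd h hij
  filter_upwards [h1, Ioo_mem_nhdsLT hr] with s hs hs0 y hy hys
  have hFsum := eq_sum_of_isHomogeneous (0 : k) hF
  rw [← hP] at hFsum
  have hterm : ∀ i ∈ Finset.range (d + 1), y.seminorm (MvPolynomial.C (P.coeff i) *
      ((MvPolynomial.X 0 - MvPolynomial.C 0 * MvPolynomial.X 1) ^ i *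
        MvPolynomial.X 1 ^ (d - i))) = absForm ![1, 0] y ^ d * (‖P.coeff i‖ * s ^ i) := by
    intro i hi
    have hi' : i ≤ d := Nat.lt_succ_iff.1 (Finset.mem_range.1 hi)
    rw [y.seminorm_C_mul, map_mul, map_pow, map_pow, seminorm_X_sub, seminorm_X_one, hys, mul_pow]
    conv_rhs => rw [← Nat.add_sub_cancel' hi', pow_add]
    ring
  apply le_antisymm
  · exact seminorm_le_gaussCone y 0 hs0.1 hys.le hF
  · obtain ⟨i, hi⟩ := Polynomial.exists_eq_gaussNorm (NormedField.toAbsoluteValue k) s P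
    rw [toAbsoluteValue_apply] at hi
    by_cases hi0 : P.coeff i = 0
    · rw [hi, hi0, norm_zero, zero_mul, mul_zero]
      exact apply_nonneg _ _
    have hid : i ∈ Finset.range (d + 1) := by
      by_contra hnot
      exact hi0 (coeff_dehomogenize_eq_zero 0 hF (by
        rw [Finset.mem_range] at hnot
        omega))
    rw [hi]
    conv_rhs => rw [hFsum]
    rw [IsNonarchimedean.apply_sum_eq_of_lt (f := y.seminorm) (fun a b => y.add_le_max a b)
      (fun a => (map_neg_eq_map _ a).symm) hid, hterm i hid]
    intro j hj hji
    rw [hterm i hid, hterm j hj]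
    refine mul_lt_mul_of_pos_left ?_ (pow_pos hy d)
    rw [← hi]
    refine lt_of_le_of_ne
      (Polynomial.le_gaussNorm (NormedField.toAbsoluteValue k) P hs0.1.le j) fun heq => ?_
    rw [hi] at heq
    change ‖P.coeff j‖ * s ^ j = ‖P.coeff i‖ * s ^ i at heq
    have hpos : 0 < ‖P.coeff i‖ * s ^ i := mul_pos (norm_pos_iff.2 hi0) (pow_pos hs0.1 i)
    have hj0 : P.coeff j ≠ 0 := by
      intro h0
      rw [h0, norm_zero, zero_mul] at heq
      exact hpos.ne heq
    have hi1 := Polynomial.mem_support_iff.2 hi0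
    have hj1 := Polynomial.mem_support_iff.2 hj0
    rcases lt_or_gt_of_ne hji with h | h
    · exact hs j hj1 i hi1 h heq
    · exact hs i hi1 j hj1 h heq.symm

theorem absForm_zero_gaussCone {t : ℝ} (ht : 0 < t) :
    absForm ![0, 1] (gaussCone k (0 : k) t ht) = t := by
  rw [absForm_gaussCone]
  simp [ht.le]

theorem absForm_infty_gaussCone (a : k) {t : ℝ} (ht : 0 < t) :
    absForm ![1, 0] (gaussCone k a t ht) = 1 := by
  rw [absForm_gaussCone]
  simp

theorem mk_gaussCone_mem_openDisc {t r : ℝ} (ht : 0 < t) :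
    ProjLine.mk (gaussCone k (0 : k) t ht) ∈ openDisc (0 : k) r ↔ t < r := by
  rw [openDisc_eq, mk_mem_openDiscAt, absForm_zero_gaussCone, absForm_infty_gaussCone, mul_one]

theorem mk_gaussCone_mem_closure {r : ℝ} (hr : 0 < r) :
    ProjLine.mk (gaussCone k (0 : k) r hr) ∈ closure (openDisc (0 : k) r) := by
  -- Truncation at `r / 2` keeps the radius positive for every real `s` and changes nothing near
  -- `r`.
  have hpos : ∀ s, 0 < max s (r / 2) := fun s => lt_max_of_lt_right (half_pos hr)
  have hcont := (continuous_mk_gaussCone (0 : k) (f := fun s => max s (r / 2))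
    (continuous_id.max continuous_const) hpos).tendsto r
  have e : max r (r / 2) = r := max_eq_left (half_le_self hr.le)
  simp only [e] at hcont
  refine mem_closure_of_tendsto (hcont.mono_left (nhdsWithin_le_nhds (s := Set.Iio r))) ?_
  filter_upwards [self_mem_nhdsWithin] with s hs
  rw [mk_gaussCone_mem_openDisc]
  exact max_lt hs (half_lt_self hr)

/-- As points of the disc approach `x`, `|Z|` tends to `r` strictly from below. By
`eventually_seminorm_eq` each homogeneous polynomial then takes the value prescribed by its Gauss
norm, and this passes to the limit. -/
theorem eq_mk_gaussCone_of_mem_frontier {r : ℝ} (hr : 0 < r) {x : ProjLine k}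
    (hx : x ∈ closure (openDisc (0 : k) r)) (hx' : x ∉ openDisc (0 : k) r) :
    x = ProjLine.mk (gaussCone k (0 : k) r hr) := by
  set f0 := normalized (form_isHomogeneous ![(0 : k), 1]) with hf0
  set f1 := normalized (form_isHomogeneous ![(1 : k), 0]) with hf1
  have c0 : Continuous f0 := continuous_normalized _
  have c1 : Continuous f1 := continuous_normalized _
  have hD : openDisc (0 : k) r = {x | f0 x < r * f1 x} := by
    rw [openDisc_eq, openDiscAt_eq_setOf_normalized]
  have hle : f0 x ≤ r * f1 x := by
    have hcl : IsClosed {x | f0 x ≤ r * f1 x} := isClosed_le c0 (continuous_const.mul c1)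
    refine closure_minimal ?_ hcl hx
    rw [hD]
    intro x hx
    have hx' : f0 x < r * f1 x := hx
    exact hx'.le
  have hge : r * f1 x ≤ f0 x := by
    rw [hD] at hx'
    exact not_lt.1 hx'
  have heq : f0 x = r * f1 x := le_antisymm hle hge
  have hf0mk : ∀ y : ConePoint k, f0 (ProjLine.mk y) = absForm ![0, 1] y /
      max (y.seminorm (MvPolynomial.X 0)) (y.seminorm (MvPolynomial.X 1)) := fun y => by
    rw [hf0, normalized_mk, pow_one]; rfl
  have hf1mk : ∀ y : ConePoint k, f1 (ProjLine.mk y) = absForm ![1, 0] y /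
      max (y.seminorm (MvPolynomial.X 0)) (y.seminorm (MvPolynomial.X 1)) := fun y => by
    rw [hf1, normalized_mk, pow_one]; rfl
  have hb : bracket ![(0 : k), 1] ![1, 0] ≠ 0 := by simp [bracket]
  have hf1pos : 0 < f1 x := by
    induction x using ProjLine.ind with
    | h y =>
      rw [hf0mk, hf1mk, ← mul_div_assoc, div_left_inj' y.max_pos.ne'] at heq
      rw [hf1mk]
      refine div_pos ?_ y.max_pos
      rcases absForm_pos_or_pos hb y with h | h
      · rw [heq] at h
        exact pos_of_mul_pos_right h hr.le
      · exact h
  have hne : (nhdsWithin x (openDisc (0 : k) r)).NeBot := mem_closure_iff_nhdsWithin_neBot.1 hx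
  set l := nhdsWithin x (openDisc (0 : k) r) with hl
  have hll : l ≤ nhds x := nhdsWithin_le_nhds
  have t0 := (c0.tendsto x).mono_left hll
  have t1 := (c1.tendsto x).mono_left hll
  have hpos1 : ∀ᶠ z in l, 0 < f1 z := t1.eventually (lt_mem_nhds hf1pos)
  have ts : Filter.Tendsto (fun z => f0 z / f1 z) l (nhds r) := by
    have := t0.div t1 hf1pos.ne'
    rwa [heq, mul_div_cancel_right₀ _ hf1pos.ne'] at this
  have ts' : Filter.Tendsto (fun z => f0 z / f1 z) l (nhdsWithin r (Set.Iio r)) := by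
    refine tendsto_nhdsWithin_iff.2 ⟨ts, ?_⟩
    filter_upwards [hpos1, self_mem_nhdsWithin] with z hz hzD
    rw [hD] at hzD
    exact (div_lt_iff₀ hz).2 hzD
  have key : ∀ (d : ℕ) (F : MvPolynomial (Fin 2) k) (hF : F.IsHomogeneous d),
      normalized hF x = f1 x ^ d *
        (dehomogenize k (0 : k) F).gaussNorm (NormedField.toAbsoluteValue k) r := by
    intro d F hF
    have tF := ((continuous_normalized hF).tendsto x).mono_left hll
    have tG := (t1.pow d).mul (((continuous_gaussNorm (dehomogenize k (0 : k) F)).tendsto r).comp ts)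
    refine tendsto_nhds_unique_of_eventuallyEq tF tG ?_
    filter_upwards [hpos1, ts'.eventually (eventually_seminorm_eq hF hr)] with z hz hz'
    induction z using ProjLine.ind with
    | h y =>
      rw [hf1mk] at hz
      have hy : 0 < absForm ![1, 0] y := by
        have := mul_pos hz y.max_pos
        rwa [div_mul_cancel₀ _ y.max_pos.ne'] at this
      have hs : f0 (ProjLine.mk y) / f1 (ProjLine.mk y) =
          absForm ![0, 1] y / absForm ![1, 0] y := by
        rw [hf0mk, hf1mk, div_div_div_cancel_right₀ y.max_pos.ne']
      rw [hs] at hz'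
      have := hz' y hy (div_mul_cancel₀ _ hy.ne').symm
      simp only [Function.comp_apply]
      rw [hs, normalized_mk, this, hf1mk, div_pow]
      ring
  induction x using ProjLine.ind with
  | h y =>
    rw [ProjLine.mk_eq_iff]
    have hy : 0 < absForm ![1, 0] y := by
      rw [hf1mk] at hf1pos
      have := mul_pos hf1pos y.max_pos
      rwa [div_mul_cancel₀ _ y.max_pos.ne'] at this
    refine ⟨_, hy, fun d F hF => ?_⟩
    have h1 := key d F hF
    rw [normalized_mk, hf1mk, div_pow, div_mul_eq_mul_div,
      div_left_inj' (pow_pos y.max_pos d).ne'] at h1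
    exact h1

theorem frontier_openDisc {r : ℝ} (hr : 0 < r) :
    frontier (openDisc (0 : k) r) = {ProjLine.mk (gaussCone k (0 : k) r hr)} := by
  have hopen : IsOpen (openDisc (0 : k) r) := by
    rw [openDisc_eq]
    exact isOpen_openDiscAt _ _ _
  rw [hopen.frontier_eq]
  ext x
  constructor
  · rintro ⟨h1, h2⟩
    exact eq_mk_gaussCone_of_mem_frontier hr h1 h2
  · rintro rfl
    exact ⟨mk_gaussCone_mem_closure hr, fun h => (mk_gaussCone_mem_openDisc hr).1 h |>.false⟩

theorem frontier_openDiscAt {p q : Fin 2 → k} (h : bracket p q ≠ 0) {r : ℝ} (hr : 0 < r) :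
    frontier (openDiscAt p q r) = {frame p q h • ProjLine.mk (gaussCone k (0 : k) r hr)} := by
  rw [openDiscAt_eq_frame_smul h, ← smul_frontier, frontier_openDisc hr, Set.smul_set_singleton]

/-- The inversion `Z ↦ 1 / Z` exchanges the radii `r` and `r⁻¹`. This brings the boundary points of
the discs around the two fixed points into one coordinate. -/
theorem frame_swap_smul_mk_gaussCone {p q : Fin 2 → k} (h : bracket p q ≠ 0)
    (h' : bracket q p ≠ 0) {r : ℝ} (hr : 0 < r) :
    frame q p h' • ProjLine.mk (gaussCone k (0 : k) r⁻¹ (inv_pos.2 hr)) =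
      frame p q h • ProjLine.mk (gaussCone k (0 : k) r hr) := by
  have hb : bracket ![(1 : k), 0] ![0, 1] ≠ 0 := by simp [bracket]
  have e1 : frame q p h' = frame p q h * frame ![(1 : k), 0] ![0, 1] hb := by
    apply Units.ext
    rw [Units.val_mul, frame_val, frame_val, frame_val]
    ext i j
    fin_cases i <;> fin_cases j <;> simp [Matrix.mul_apply, Fin.sum_univ_two]
  have hr' := hr.le
  rw [e1, mul_smul, smul_mk_gaussCone_eq (frame ![(1 : k), 0] ![0, 1] hb) 0 0 (inv_pos.2 hr) hr]
  · rw [absForm_gl_smul, absForm_gl_smul, absForm_gaussCone, absForm_gaussCone]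
    simp [frame_val, hr', hr.ne']
  · rw [absForm_gl_inv_smul, absForm_gl_inv_smul, absForm_gaussCone, absForm_gaussCone]
    simp [frame_val, hr', hr.ne', Matrix.mulVec, dotProduct, Fin.sum_univ_two]
  · rw [absForm_gl_smul, absForm_gl_inv_smul, absForm_gaussCone, absForm_gaussCone]
    simp [frame_val, hr', hr.ne', Matrix.mulVec, dotProduct, Fin.sum_univ_two]

/-! ### Segments -/

theorem Path.exists_mem_frontier {X : Type*} [TopologicalSpace X] {x y : X} (φ : Path x y)
    {D : Set X} (hx : x ∈ D) (hy : y ∉ D) : ∃ z ∈ Set.range φ, z ∈ frontier D := by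
  by_contra! hcon
  have hsub : Set.range φ ⊆ interior D ∪ (closure D)ᶜ := by
    intro z hz
    by_cases h1 : z ∈ closure D
    · by_cases h2 : z ∈ interior D
      · exact Or.inl h2
      · exact absurd ⟨h1, h2⟩ (hcon z hz)
    · exact Or.inr h1
  have hx1 : x ∈ Set.range φ := ⟨0, φ.source⟩
  have hy1 : y ∈ Set.range φ := ⟨1, φ.target⟩
  obtain ⟨z, -, hz1, hz2⟩ := isPreconnected_range φ.continuous _ _ isOpen_interior
    isClosed_closure.isOpen_compl hsub
    ⟨x, hx1, (hsub hx1).resolve_right fun h => h (subset_closure hx)⟩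
    ⟨y, hy1, (hsub hy1).resolve_left fun h => hy (interior_subset h)⟩
  exact hz2 (subset_closure (interior_subset hz1))

/-- Varying the radius linearly gives a path with no other points. Conversely, a path leaving the
disc of radius `t` must cross its frontier, which is the single point of radius `t`. -/
theorem segment_smul_mk_gaussCone (g : GL (Fin 2) k) {m M : ℝ} (hm : 0 < m) (hmM : m ≤ M) :
    segment (g • ProjLine.mk (gaussCone k (0 : k) m hm))
      (g • ProjLine.mk (gaussCone k (0 : k) M (hm.trans_le hmM))) = g • gaussSegment k m M := by
  have hM := hm.trans_le hmM
  apply Set.Subset.antisymm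
  · have hpos : ∀ τ : unitInterval, 0 < (1 - (τ : ℝ)) * m + τ * M := by
      intro τ
      have h0 := τ.2.1
      have h1 := τ.2.2
      nlinarith
    have hcont : Continuous fun τ : unitInterval => (1 - (τ : ℝ)) * m + τ * M := by fun_prop
    let φ : Path (g • ProjLine.mk (gaussCone k (0 : k) m hm))
        (g • ProjLine.mk (gaussCone k (0 : k) M hM)) :=
      { toFun := fun τ => g • ProjLine.mk (gaussCone k (0 : k) _ (hpos τ))
        continuous_toFun := (continuous_mk_gaussCone (0 : k) hcont hpos).const_smul g
        source' := by simp
        target' := by simp }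
    refine (Set.iInter_subset _ φ).trans ?_
    rintro _ ⟨τ, rfl⟩
    refine Set.smul_mem_smul_set (?_ : ProjLine.mk (gaussCone k (0 : k) _ (hpos τ)) ∈
      gaussSegment k m M)
    refine ⟨_, ⟨?_, ?_⟩, isEta_gaussCone _ (hpos τ)⟩
    · have h0 := τ.2.1
      nlinarith
    · have h1 := τ.2.2
      nlinarith
  · rintro _ ⟨x, ⟨t, ht, hx⟩, rfl⟩
    have ht0 := hm.trans_le ht.1
    rw [isEta_iff _ ht0] at hx
    subst hx
    refine Set.mem_iInter.2 fun φ => ?_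
    change g • ProjLine.mk (gaussCone k (0 : k) t ht0) ∈ Set.range φ
    -- For `t = m` the source is not inside the open disc of radius `t`, but it is the desired point
    -- itself.
    rcases ht.1.eq_or_lt with rfl | hlt
    · exact ⟨0, φ.source⟩
    have hfr : frontier (g • openDisc (0 : k) t) =
        {g • ProjLine.mk (gaussCone k (0 : k) t ht0)} := by
      rw [← smul_frontier, frontier_openDisc ht0, Set.smul_set_singleton]
    obtain ⟨z, hz, hz'⟩ := Path.exists_mem_frontier φ (D := g • openDisc (0 : k) t)
      (Set.smul_mem_smul_set ((mk_gaussCone_mem_openDisc hm).2 hlt)) (by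
        rw [Set.smul_mem_smul_set_iff, mk_gaussCone_mem_openDisc]
        exact ht.2.not_gt)
    rw [hfr, Set.mem_singleton_iff] at hz'
    rwa [← hz']

end

section

variable {k : Type u} [NormedField k]

/-! ### The condition on the cross-ratios -/

/-- The absolute value at `a` of a coordinate with a zero at `p` and a pole at `q`. -/
def absRatio (p q a : Projectivization k (Fin 2 → k)) : ℝ :=
  ‖bracket a.rep p.rep‖ / ‖bracket a.rep q.rep‖

theorem norm_bracket_rep_pos {p q : Projectivization k (Fin 2 → k)} (h : p ≠ q) :
    0 < ‖bracket p.rep q.rep‖ := norm_pos_iff.2 (bracket_rep_ne_zero h)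

theorem absRatio_pos {p q a : Projectivization k (Fin 2 → k)} (hp : a ≠ p) (hq : a ≠ q) :
    0 < absRatio p q a := div_pos (norm_bracket_rep_pos hp) (norm_bracket_rep_pos hq)

theorem absRatio_swap (p q a : Projectivization k (Fin 2 → k)) :
    absRatio q p a = (absRatio p q a)⁻¹ := (inv_div _ _).symm

/-- The cross-ratio is `Z(a) / Z(b)` for a coordinate `Z` with zero `p` and pole `q`. -/
theorem norm_crossRatio (a b p q : Projectivization k (Fin 2 → k)) :
    ‖crossRatio a b p q‖ = absRatio p q a / absRatio p q b := by
  simp only [crossRatio, pairing_eq_bracket, absRatio, norm_div, norm_mul, div_div_div_eq]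

theorem ratPoint_mem_openDiscAt_rep {p q a : Projectivization k (Fin 2 → k)} (h : a ≠ q) {ρ : ℝ} :
    ratPoint a ∈ openDiscAt p.rep q.rep ρ ↔ absRatio p q a < ρ := by
  rw [ratPoint_mem_openDiscAt, absRatio, div_lt_iff₀ (norm_bracket_rep_pos h)]

theorem ratPoint_mem_closedDiscAt_rep {p q a : Projectivization k (Fin 2 → k)} (h : a ≠ q)
    {ρ : ℝ} : ratPoint a ∈ closedDiscAt p.rep q.rep ρ ↔ absRatio p q a ≤ ρ := by
  rw [ratPoint_mem_closedDiscAt, absRatio, div_le_iff₀ (norm_bracket_rep_pos h)]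

theorem absRatio_self (p q : Projectivization k (Fin 2 → k)) : absRatio p q p = 0 := by
  rw [absRatio, bracket_self, norm_zero, zero_div]

theorem ratPoint_notMem_openDiscAt_rep (p q : Projectivization k (Fin 2 → k)) (ρ : ℝ) :
    ratPoint q ∉ openDiscAt p.rep q.rep ρ := by
  rw [ratPoint_mem_openDiscAt, bracket_self, norm_zero, mul_zero]
  exact (norm_nonneg _).not_gt

theorem ratPoint_notMem_closedDiscAt_rep {p q : Projectivization k (Fin 2 → k)} (h : q ≠ p)
    (ρ : ℝ) : ratPoint q ∉ closedDiscAt p.rep q.rep ρ := by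
  rw [ratPoint_mem_closedDiscAt, bracket_self, norm_zero, mul_zero]
  exact (norm_bracket_rep_pos h).not_ge

/-! ### Fixed points -/

/-- The attracting fixed point of `γᵢ^ε`. -/
def fixedPoint {g : ℕ} (α α' : Fin g → Projectivization k (Fin 2 → k)) (i : Fin g) (ε : ℤˣ) :
    Projectivization k (Fin 2 → k) := if ε = 1 then α i else α' i

theorem fixedPoint_injective {g : ℕ} {α α' : Fin g → Projectivization k (Fin 2 → k)}
    (h : Function.Injective (Sum.elim α α')) {i j : Fin g} {ε δ : ℤˣ}
    (he : fixedPoint α α' i ε = fixedPoint α α' j δ) : (i, ε) = (j, δ) := by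
  have h1 : ∀ i j, α i ≠ α' j := fun i j e =>
    Sum.inl_ne_inr (h (a₁ := Sum.inl i) (a₂ := Sum.inr j) e)
  have h2 : ∀ i j, α i = α j → i = j := fun i j e =>
    Sum.inl_injective (h (a₁ := Sum.inl i) (a₂ := Sum.inl j) e)
  have h3 : ∀ i j, α' i = α' j → i = j := fun i j e =>
    Sum.inr_injective (h (a₁ := Sum.inr i) (a₂ := Sum.inr j) e)
  have h4 : (-1 : ℤˣ) ≠ 1 := by decide
  rcases Int.units_eq_one_or ε with rfl | rfl <;> rcases Int.units_eq_one_or δ with rfl | rfl <;>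
    simp only [fixedPoint, if_true, if_neg h4] at he
  · rw [h2 _ _ he]
  · exact absurd he (h1 _ _)
  · exact absurd he.symm (h1 _ _)
  · rw [h3 _ _ he]

theorem zpow_eq_koebe_fixedPoint {g : ℕ} {α α' : Fin g → Projectivization k (Fin 2 → k)}
    {β : Fin g → k} {γ : Fin g → Matrix.ProjGenLinGroup (Fin 2) k} (hβ : ∀ i, 0 < ‖β i‖) (hne : ∀ i, α i ≠ α' i)
    (hγ : ∀ i, γ i = koebe (α i) (α' i) (β i) (hne i) (hβ i)) (i : Fin g) (ε : ℤˣ)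
    (h : fixedPoint α α' i ε ≠ fixedPoint α α' i (-ε)) :
    γ i ^ (ε : ℤ) = koebe (fixedPoint α α' i ε) (fixedPoint α α' i (-ε)) (β i) h (hβ i) := by
  have h4 : (-1 : ℤˣ) ≠ 1 := by decide
  rcases Int.units_eq_one_or ε with rfl | rfl
  · simp only [fixedPoint, if_true, if_neg h4, Units.val_one, zpow_one, hγ]
  · simp only [fixedPoint, if_true, if_neg h4, neg_neg, Units.val_neg, Units.val_one, zpow_neg,
      zpow_one, hγ]
    exact (koebe_swap _ _ _ _ _).symm

/-! ### Boundary points -/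

variable [IsUltrametricDist k]

/-- A competing disc contains `p` and misses `q`, hence has the form `{|Z| < ρ}`. Missing a point
where the minimum `m` is attained forces `ρ ≤ m`. -/
theorem isBiggestDisc_openDiscAt {p q : Projectivization k (Fin 2 → k)} (hpq : p ≠ q)
    {A : Set (Projectivization k (Fin 2 → k))} (hq : q ∈ A) {m : ℝ} (hm : 0 < m)
    (hle : ∀ a ∈ A \ {p, q}, m ≤ absRatio p q a) (hex : ∃ a ∈ A \ {p, q}, absRatio p q a = m) :
    IsBiggestDisc p A (openDiscAt p.rep q.rep m) := by
  refine ⟨⟨isOpenDisc_openDiscAt (bracket_rep_ne_zero hpq) hm, ?_, ?_⟩, ?_⟩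
  · rwa [ratPoint_mem_openDiscAt_rep hpq, absRatio_self]
  · intro b hb hbp
    by_cases hbq : b = q
    · exact hbq ▸ ratPoint_notMem_openDiscAt_rep p q m
    · rw [ratPoint_mem_openDiscAt_rep hbq]
      exact (hle b ⟨hb, by simp [hbp, hbq]⟩).not_gt
  · rintro E ⟨hE, hpE, hAE⟩
    obtain ⟨ρ, -, rfl⟩ := hE.exists_eq hpE (hAE q hq hpq.symm)
    obtain ⟨a, ⟨haA, ha⟩, rfl⟩ := hex
    rw [Set.mem_insert_iff, Set.mem_singleton_iff, not_or] at ha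
    have := hAE a haA ha.1
    rw [ratPoint_mem_openDiscAt_rep ha.2, not_lt] at this
    exact openDiscAt_mono _ _ this

theorem isDiscBoundaryPoint_iff {p q : Projectivization k (Fin 2 → k)} (hpq : p ≠ q)
    {A : Set (Projectivization k (Fin 2 → k))} (hq : q ∈ A) {m : ℝ} (hm : 0 < m)
    (hle : ∀ a ∈ A \ {p, q}, m ≤ absRatio p q a) (hex : ∃ a ∈ A \ {p, q}, absRatio p q a = m)
    (x : ProjLine k) : IsDiscBoundaryPoint p A x ↔
      x = frame p.rep q.rep (bracket_rep_ne_zero hpq) •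
        ProjLine.mk (gaussCone k (0 : k) m hm) := by
  have hD := isBiggestDisc_openDiscAt hpq hq hm hle hex
  have hfr := frontier_openDiscAt (bracket_rep_ne_zero hpq) hm
  constructor
  · rintro ⟨D, hD', hx⟩
    rw [hD'.unique hD, hfr] at hx
    exact (Set.singleton_eq_singleton_iff.1 hx).symm
  · rintro rfl
    exact ⟨_, hD, hfr⟩

/-- The length is the quotient of the maximum of `|Z|` on the remaining points by its minimum, that
is, the largest of the quotients on the right. -/
theorem exists_length_lt_iff {p q : Projectivization k (Fin 2 → k)} (hpq : p ≠ q)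
    {A : Set (Projectivization k (Fin 2 → k))} (hp : p ∈ A) (hq : q ∈ A) (hA : A.Finite)
    (hne : (A \ {p, q}).Nonempty) (c : ℝ) :
    (∃ (x x' : ProjLine k) (L : ℝ), IsDiscBoundaryPoint p A x ∧ IsDiscBoundaryPoint q A x' ∧
      HasLength (segment x x') L ∧ L < c) ↔
    ∀ a ∈ A \ {p, q}, ∀ b ∈ A \ {p, q}, absRatio p q a / absRatio p q b < c := by
  obtain ⟨b, hb, hbmin⟩ := Set.exists_min_image _ (absRatio p q) hA.sdiff hne
  obtain ⟨a, ha, hamax⟩ := Set.exists_max_image _ (absRatio p q) hA.sdiff hne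
  have hpos : ∀ x ∈ A \ {p, q}, 0 < absRatio p q x := by
    rintro x ⟨-, hx⟩
    rw [Set.mem_insert_iff, Set.mem_singleton_iff, not_or] at hx
    exact absRatio_pos hx.1 hx.2
  have hm := hpos b hb
  have hM := hpos a ha
  have h1 := isDiscBoundaryPoint_iff hpq hq hm hbmin ⟨b, hb, rfl⟩
  have h2 := isDiscBoundaryPoint_iff (A := A) hpq.symm hp (inv_pos.2 hM)
    (fun x hx => by
      rw [Set.pair_comm] at hx
      rw [absRatio_swap p q x]
      exact inv_anti₀ (hpos x hx) (hamax x hx))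
    ⟨a, by rwa [Set.pair_comm], absRatio_swap _ _ _⟩
  have hswap := frame_swap_smul_mk_gaussCone (bracket_rep_ne_zero hpq)
    (bracket_rep_ne_zero hpq.symm) hM
  rw [hswap] at h2
  have hseg := segment_smul_mk_gaussCone (frame p.rep q.rep (bracket_rep_ne_zero hpq)) hm
    (hbmin a ha)
  have hlen := hasLength_smul_gaussSegment_iff (frame p.rep q.rep (bracket_rep_ne_zero hpq)) hm
    (hbmin a ha)
  simp only [h1, h2]
  constructor
  · rintro ⟨x, x', L, rfl, rfl, hL, hLc⟩ a' ha' b' hb'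
    rw [hseg, hlen] at hL
    refine lt_of_le_of_lt ?_ (hL ▸ hLc)
    exact div_le_div₀ hM.le (hamax a' ha') hm (hbmin b' hb')
  · intro h
    exact ⟨_, _, _, rfl, rfl, by rw [hseg, hlen], h a ha b hb⟩

/-! ### Schottky figures -/

/-- A larger open disc inside the closed one still contains `p` and misses `q`, so it is concentric
and its radius is at most `ρ`. -/
theorem maximal_openDiscAt {p q : Projectivization k (Fin 2 → k)} (hpq : p ≠ q) {ρ : ℝ}
    (hρ : 0 < ρ) : Maximal (fun D => IsOpenDisc D ∧ D ⊆ closedDiscAt p.rep q.rep ρ)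
      (openDiscAt p.rep q.rep ρ) := by
  have hb := bracket_rep_ne_zero hpq
  refine ⟨⟨isOpenDisc_openDiscAt hb hρ, openDiscAt_subset_closedDiscAt _ _ _⟩, ?_⟩
  rintro E ⟨hE, hsub⟩ hle
  have hpE : ratPoint p ∈ E := hle (by
    rwa [ratPoint_mem_openDiscAt_rep hpq, absRatio_self])
  obtain ⟨s, -, rfl⟩ := hE.exists_eq hpE
    (fun h => ratPoint_notMem_closedDiscAt_rep hpq.symm ρ (hsub h))
  exact openDiscAt_mono _ _ (le_of_openDiscAt_subset_closedDiscAt hb hρ hsub)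

variable {g : ℕ} {α α' : Fin g → Projectivization k (Fin 2 → k)} {β : Fin g → k}
  {γ : Fin g → Matrix.ProjGenLinGroup (Fin 2) k}

/-- The complement of `B i ε` is an open disc that `γ i ^ (-ε)` sends into `B i (-ε)`, hence into
itself. So it omits the repelling fixed point of `γ i ^ (-ε)`, which is the attracting one of `γ i ^
ε`. -/
theorem IsSchottkyFigure.fixedPoint_mem {B : Fin g → ℤˣ → Set (ProjLine k)}
    (hB : IsSchottkyFigure γ B) (hdist : Function.Injective (Sum.elim α α'))
    (hβ : ∀ i, 0 < ‖β i‖) (hβ1 : ∀ i, ‖β i‖ < 1) (hne : ∀ i, α i ≠ α' i)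
    (hγ : ∀ i, γ i = koebe (α i) (α' i) (β i) (hne i) (hβ i)) (i : Fin g) (ε : ℤˣ) :
    ratPoint (fixedPoint α α' i ε) ∈ B i ε := by
  have hneg : ε ≠ -ε := by
    rcases Int.units_eq_one_or ε with rfl | rfl <;> decide
  have h : fixedPoint α α' i (-ε) ≠ fixedPoint α α' i ε :=
    fun e => hneg (Prod.ext_iff.1 (fixedPoint_injective hdist e)).2.symm
  have hmax := (hB.maximal i (-ε)).prop.2
  rw [innerDisc, zpow_eq_koebe_fixedPoint hβ hne hγ i (-ε) (by rwa [neg_neg])] at hmax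
  simp only [neg_neg] at hmax
  have hdis : Disjoint (B i (-ε)) (B i ε) :=
    hB.disjoint (i := (i, -ε)) (j := (i, ε)) fun e => hneg (Prod.ext_iff.1 e).2.symm
  exact not_not.1 (ratPoint_notMem_of_koebe_smul_subset h (hβ i) (hβ1 i)
    (isOpenDisc_compl_iff.2 (hB.isClosedDisc i ε)) (hmax.trans hdis.subset_compl_right))

theorem IsSchottkyFigure.mul_div_lt_one {B : Fin g → ℤˣ → Set (ProjLine k)}
    (hB : IsSchottkyFigure γ B) (hdist : Function.Injective (Sum.elim α α'))
    (hβ : ∀ i, 0 < ‖β i‖) (hβ1 : ∀ i, ‖β i‖ < 1) (hne : ∀ i, α i ≠ α' i)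
    (hγ : ∀ i, γ i = koebe (α i) (α' i) (β i) (hne i) (hβ i)) {i j l : Fin g} (hj : j ≠ i)
    (hl : l ≠ i) (δ η : ℤˣ) :
    ‖β i‖ * (absRatio (α i) (α' i) (fixedPoint α α' j δ) /
      absRatio (α i) (α' i) (fixedPoint α α' l η)) < 1 := by
  have hmem := hB.fixedPoint_mem hdist hβ hβ1 hne hγ
  have hnot : ∀ {i j : Fin g} {ε δ : ℤˣ}, (j, δ) ≠ (i, ε) →
      ratPoint (fixedPoint α α' j δ) ∉ B i ε := fun h h' =>
    Set.disjoint_left.1 (hB.disjoint h) (hmem _ _) h'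
  have h4 : (-1 : ℤˣ) ≠ 1 := by decide
  have f1 : fixedPoint α α' i 1 = α i := by simp [fixedPoint]
  have f2 : fixedPoint α α' i (-1) = α' i := by simp [fixedPoint, h4]
  have m1 := hmem i 1
  have m2 := hmem i (-1)
  have n1 : ratPoint (fixedPoint α α' i (-1)) ∉ B i 1 := hnot (by simp [h4])
  have n2 : ratPoint (fixedPoint α α' i 1) ∉ B i (-1) := hnot (by simp [h4.symm])
  obtain ⟨r, hr, e1⟩ := (hB.isClosedDisc i 1).exists_eq m1 n1
  obtain ⟨r', hr', e2⟩ := (hB.isClosedDisc i (-1)).exists_eq m2 n2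
  rw [f1, f2] at e1 e2
  have hmax := (hB.maximal i 1).prop.2
  rw [innerDisc, e2, e1, Units.val_one, zpow_one, hγ i, koebe_smul_closedDiscAt_swap _ _ hr'] at hmax
  -- The inner disc `{|Z| < |β| / r'}` is contained in `{|Z| ≤ r}`.
  have hle := le_of_openDiscAt_subset_closedDiscAt (bracket_rep_ne_zero (hne i)) hr hmax
  rw [div_le_iff₀ hr'] at hle
  -- The fixed points of the other generators lie in the open annulus `r < |Z| < 1 / r'`.
  have key : ∀ j, j ≠ i → ∀ δ, r < absRatio (α i) (α' i) (fixedPoint α α' j δ) ∧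
      r' * absRatio (α i) (α' i) (fixedPoint α α' j δ) < 1 := by
    intro j hj δ
    have g1 : fixedPoint α α' j δ ≠ α i := fun e => by
      rw [← f1] at e
      exact hj (Prod.ext_iff.1 (fixedPoint_injective hdist e)).1
    have g2 : fixedPoint α α' j δ ≠ α' i := fun e => by
      rw [← f2] at e
      exact hj (Prod.ext_iff.1 (fixedPoint_injective hdist e)).1
    have k1 : ratPoint (fixedPoint α α' j δ) ∉ B i 1 := hnot fun e => hj (Prod.ext_iff.1 e).1
    have k2 : ratPoint (fixedPoint α α' j δ) ∉ B i (-1) := hnot fun e => hj (Prod.ext_iff.1 e).1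
    rw [e1, ratPoint_mem_closedDiscAt_rep g2, not_le] at k1
    rw [e2, ratPoint_mem_closedDiscAt_rep g1, not_le, absRatio_swap] at k2
    exact ⟨k1, by rwa [lt_inv_comm₀ hr' (hr.trans k1), ← one_div, lt_div_iff₀' hr'] at k2⟩
  obtain ⟨a1, a2⟩ := key j hj δ
  obtain ⟨b1, b2⟩ := key l hl η
  have ha := hr.trans a1
  rw [← mul_div_assoc, div_lt_one (hr.trans b1)]
  calc _ ≤ r * r' * absRatio (α i) (α' i) (fixedPoint α α' j δ) := by gcongr
    _ = r * (r' * absRatio (α i) (α' i) (fixedPoint α α' j δ)) := by ring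
    _ < r * 1 := mul_lt_mul_of_pos_left a2 hr
    _ < _ := by rwa [mul_one]

theorem exists_isSchottkyFigure (hg : 2 ≤ g) (hdist : Function.Injective (Sum.elim α α'))
    (hβ : ∀ i, 0 < ‖β i‖) (hne : ∀ i, α i ≠ α' i)
    (hγ : ∀ i, γ i = koebe (α i) (α' i) (β i) (hne i) (hβ i))
    (h : ∀ i j l, j ≠ i → l ≠ i → ∀ δ η, ‖β i‖ *
      (absRatio (α i) (α' i) (fixedPoint α α' j δ) /
        absRatio (α i) (α' i) (fixedPoint α α' l η)) < 1) :
    ∃ B : Fin g → ℤˣ → Set (ProjLine k), IsSchottkyFigure γ B := by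
  have h4 : (-1 : ℤˣ) ≠ 1 := by decide
  have f1 : ∀ i, fixedPoint α α' i 1 = α i := fun i => by simp [fixedPoint]
  have f2 : ∀ i, fixedPoint α α' i (-1) = α' i := fun i => by simp [fixedPoint, h4]
  have hneg : ∀ ε : ℤˣ, -ε ≠ ε := fun ε => by
    rcases Int.units_eq_one_or ε with rfl | rfl <;> decide
  have hfne : ∀ {i j : Fin g} {ε δ : ℤˣ}, (i, ε) ≠ (j, δ) →
      fixedPoint α α' i ε ≠ fixedPoint α α' j δ := fun hij e => hij (fixedPoint_injective hdist e)
  have hother : ∀ i : Fin g, ∃ j, j ≠ i := fun i => by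
    have : Nontrivial (Fin g) := Fin.nontrivial_iff_two_le.2 hg
    exact exists_ne i
  have hpos : ∀ i j : Fin g, j ≠ i → ∀ δ, 0 < absRatio (α i) (α' i) (fixedPoint α α' j δ) := by
    intro i j hj δ
    refine absRatio_pos ?_ ?_
    · rw [← f1]; exact hfne fun e => hj (Prod.ext_iff.1 e).1
    · rw [← f2]; exact hfne fun e => hj (Prod.ext_iff.1 e).1
  -- The hypothesis at a maximizing and a minimizing point leaves room for `r` strictly between `|β
  -- i|` times the maximum and the minimum.
  have hr : ∀ i, ∃ r : ℝ, 0 < r ∧ ∀ j, j ≠ i → ∀ δ,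
      r < absRatio (α i) (α' i) (fixedPoint α α' j δ) ∧
      ‖β i‖ * absRatio (α i) (α' i) (fixedPoint α α' j δ) < r := by
    intro i
    obtain ⟨j0, hj0⟩ := hother i
    set S : Set (Fin g × ℤˣ) := {x | x.1 ≠ i} with hS
    set f : Fin g × ℤˣ → ℝ := fun x => absRatio (α i) (α' i) (fixedPoint α α' x.1 x.2) with hf
    have hSne : S.Nonempty := ⟨(j0, 1), hj0⟩
    obtain ⟨b, hb, hbmin⟩ := Set.exists_min_image S f S.toFinite hSne
    obtain ⟨a, ha, hamax⟩ := Set.exists_max_image S f S.toFinite hSne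
    have hlt := h i a.1 b.1 ha hb a.2 b.2
    have hb0 := hpos i b.1 hb b.2
    rw [← mul_div_assoc, div_lt_one hb0] at hlt
    obtain ⟨r, h1, h2⟩ := exists_between hlt
    refine ⟨r, (mul_pos (hβ i) (hpos i a.1 ha a.2)).trans h1, fun j hj δ => ⟨?_, ?_⟩⟩
    · exact h2.trans_le (hbmin (j, δ) hj)
    · exact (mul_le_mul_of_nonneg_left (hamax (j, δ) hj) (hβ i).le).trans_lt h1
  choose r hr0 hr using hr
  -- The radius for `ε = -1` refers to the coordinate `1 / Z`: that disc is `{|Z| ≥ r i / |β i|}`,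
  -- whose complement `γ i` sends onto `{|Z| < r i}`.
  set ρ : Fin g → ℤˣ → ℝ := fun i ε => if ε = 1 then r i else ‖β i‖ / r i with hρ
  have hρ1 : ∀ i, ρ i 1 = r i := fun i => by simp [hρ]
  have hρ2 : ∀ i, ρ i (-1) = ‖β i‖ / r i := fun i => by simp [hρ, h4]
  have hρ0 : ∀ i ε, 0 < ρ i ε := fun i ε => by
    rcases Int.units_eq_one_or ε with rfl | rfl
    · rw [hρ1]; exact hr0 i
    · rw [hρ2]; exact div_pos (hβ i) (hr0 i)
  have hρmul : ∀ i ε, ‖β i‖ / ρ i (-ε) = ρ i ε := fun i ε => by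
    have := hr0 i
    have := hβ i
    rcases Int.units_eq_one_or ε with rfl | rfl
    · rw [hρ1, hρ2]; field_simp
    · rw [neg_neg, hρ1, hρ2]
  set B : Fin g → ℤˣ → Set (ProjLine k) := fun i ε =>
    closedDiscAt (fixedPoint α α' i ε).rep (fixedPoint α α' i (-ε)).rep (ρ i ε) with hB
  have hcc : ∀ i ε, fixedPoint α α' i ε ≠ fixedPoint α α' i (-ε) := fun i ε =>
    hfne fun e => hneg ε (Prod.ext_iff.1 e).2.symm
  have hclosed : ∀ i ε, IsClosedDisc (B i ε) := fun i ε =>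
    isClosedDisc_closedDiscAt (bracket_rep_ne_zero (hcc i ε)) (hρ0 i ε)
  have hmem : ∀ i ε, ratPoint (fixedPoint α α' i ε) ∈ B i ε := fun i ε => by
    rw [ratPoint_mem_closedDiscAt_rep (hcc i ε), absRatio_self]
    exact (hρ0 i ε).le
  have hnot : ∀ {i j : Fin g} {ε δ : ℤˣ}, (j, δ) ≠ (i, ε) →
      ratPoint (fixedPoint α α' j δ) ∉ B i ε := by
    intro i j ε δ hij
    by_cases hji : j = i
    · subst hji
      have : δ = -ε := by
        have hδ : δ ≠ ε := fun e => hij (by rw [e])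
        rcases Int.units_eq_one_or ε with rfl | rfl <;>
          rcases Int.units_eq_one_or δ with rfl | rfl <;> simp_all
      subst this
      exact ratPoint_notMem_closedDiscAt_rep (hcc j ε).symm _
    · have hne' : fixedPoint α α' j δ ≠ fixedPoint α α' i (-ε) :=
        hfne fun e => hji (Prod.ext_iff.1 e).1
      rw [ratPoint_mem_closedDiscAt_rep hne', not_le]
      obtain ⟨k1, k2⟩ := hr i j hji δ
      have h0 := hpos i j hji δ
      rcases Int.units_eq_one_or ε with rfl | rfl
      · rw [f1, f2, hρ1]; exact k1
      · rw [neg_neg, f1, f2, hρ2, absRatio_swap, div_lt_iff₀ (hr0 i), lt_inv_mul_iff₀ h0, mul_comm]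
        exact k2
  refine ⟨B, ?_, ?_, hclosed, ?_⟩
  · exact fun i ε => isClosed_closedDiscAt _ _ (hρ0 i ε)
  · rintro ⟨i, ε⟩ ⟨j, δ⟩ hij
    -- The disjointness criterion needs a rational point outside both discs. A third fixed point
    -- serves; for two discs of the same generator it comes from another generator, which exists
    -- since `g ≥ 2`.
    obtain ⟨⟨l, η⟩, hl1, hl2⟩ : ∃ x : Fin g × ℤˣ, x ≠ (i, ε) ∧ x ≠ (j, δ) := by
      by_cases hji : j = i
      · obtain ⟨l, hl⟩ := hother i
        exact ⟨(l, 1), fun e => hl (Prod.ext_iff.1 e).1,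
          fun e => hl ((Prod.ext_iff.1 e).1.trans hji)⟩
      · exact ⟨(i, -ε), fun e => hneg ε (Prod.ext_iff.1 e).2,
          fun e => hji (Prod.ext_iff.1 e).1.symm⟩
    exact (hclosed i ε).disjoint (hclosed j δ) (hmem i ε) (hmem j δ) (hnot hij) (hnot hij.symm)
      (hnot hl1) (hnot hl2)
  · intro i ε
    have e : innerDisc γ B i ε =
        openDiscAt (fixedPoint α α' i ε).rep (fixedPoint α α' i (-ε)).rep (ρ i ε) := by
      rw [innerDisc, zpow_eq_koebe_fixedPoint hβ hne hγ i ε (hcc i ε), hB]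
      simp only [neg_neg]
      rw [koebe_smul_closedDiscAt_swap _ _ (hρ0 i (-ε)), hρmul]
    rw [e]
    exact maximal_openDiscAt (hcc i ε) (hρ0 i ε)

end

end Berkovich

end

/-! ### The equivalence of the three conditions. -/

theorem proposition4p11 {k : Type u} [NormedField k] [CompleteSpace k] [IsUltrametricDist k]
    {g : ℕ} (hg : 2 ≤ g)
    (α α' : Fin g → Projectivization k (Fin 2 → k))
    (hdist : Function.Injective (Sum.elim α α'))
    (β : Fin g → k) (hβ : ∀ i, 0 < ‖β i‖ ∧ ‖β i‖ < 1)
    (A : Set (Projectivization k (Fin 2 → k))) (hA : A = Set.range α ∪ Set.range α')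
    (γ : Fin g → Matrix.ProjGenLinGroup (Fin 2) k)
    (hγ : ∀ i, γ i = Berkovich.koebe (α i) (α' i) (β i)
      (fun h => Sum.inl_ne_inr (hdist (a₁ := Sum.inl i) (a₂ := Sum.inr i) h)) (hβ i).1) :
    List.TFAE
      [∃ B : Fin g → ℤˣ → Set (Berkovich.ProjLine k), Berkovich.IsSchottkyFigure γ B,
       ∀ i, ∃ (p p' : Berkovich.ProjLine k) (L : ℝ),
         Berkovich.IsDiscBoundaryPoint (α i) A p ∧ Berkovich.IsDiscBoundaryPoint (α' i) A p' ∧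
         Berkovich.HasLength (Berkovich.segment p p') L ∧ L < ‖β i‖⁻¹,
       ∀ i j l, j ≠ i → l ≠ i →
         ∀ a ∈ ({α j, α' j} : Set (Projectivization k (Fin 2 → k))),
         ∀ b ∈ ({α l, α' l} : Set (Projectivization k (Fin 2 → k))),
           ‖β i‖ * ‖Berkovich.crossRatio a b (α i) (α' i)‖ < 1] := by
  have hne : ∀ i, α i ≠ α' i := fun i h =>
    Sum.inl_ne_inr (hdist (a₁ := Sum.inl i) (a₂ := Sum.inr i) h)
  have h4 : (-1 : ℤˣ) ≠ 1 := by decide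
  have f1 : ∀ i, Berkovich.fixedPoint α α' i 1 = α i := fun i => by simp [Berkovich.fixedPoint]
  have f2 : ∀ i, Berkovich.fixedPoint α α' i (-1) = α' i := fun i => by
    simp [Berkovich.fixedPoint, h4]
  have hpair : ∀ j a, a ∈ ({α j, α' j} : Set (Projectivization k (Fin 2 → k))) ↔
      ∃ δ, Berkovich.fixedPoint α α' j δ = a := by
    intro j a
    rw [Set.mem_insert_iff, Set.mem_singleton_iff]
    constructor
    · rintro (rfl | rfl)
      · exact ⟨1, f1 j⟩
      · exact ⟨-1, f2 j⟩
    · rintro ⟨δ, rfl⟩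
      rcases Int.units_eq_one_or δ with rfl | rfl
      · exact Or.inl (f1 j)
      · exact Or.inr (f2 j)
  have hA' : ∀ a, a ∈ A ↔ ∃ j, a ∈ ({α j, α' j} : Set (Projectivization k (Fin 2 → k))) := by
    intro a
    rw [hA]
    simp only [Set.mem_union, Set.mem_range, Set.mem_insert_iff, Set.mem_singleton_iff,
      exists_or, eq_comm]
  -- Distinctness of the fixed points matches the set difference of condition 2 with the index
  -- restrictions `j ≠ i`, `l ≠ i` of condition 3.
  have hAi : ∀ i a, a ∈ A \ {α i, α' i} ↔
      ∃ j, j ≠ i ∧ a ∈ ({α j, α' j} : Set (Projectivization k (Fin 2 → k))) := by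
    intro i a
    constructor
    · rintro ⟨ha, hai⟩
      obtain ⟨j, hj⟩ := (hA' a).1 ha
      exact ⟨j, fun e => hai (e ▸ hj), hj⟩
    · rintro ⟨j, hji, hj⟩
      refine ⟨(hA' a).2 ⟨j, hj⟩, fun hai => hji ?_⟩
      obtain ⟨δ, rfl⟩ := (hpair j a).1 hj
      obtain ⟨ε, hε⟩ := (hpair i _).1 hai
      exact (Prod.ext_iff.1 (Berkovich.fixedPoint_injective hdist hε)).1.symm
  have hfin : A.Finite := hA ▸ (Set.finite_range α).union (Set.finite_range α')
  tfae_have 1 ↔ 3 := by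
    constructor
    · rintro ⟨B, hB⟩ i j l hj hl a ha b hb
      obtain ⟨δ, rfl⟩ := (hpair j a).1 ha
      obtain ⟨η, rfl⟩ := (hpair l b).1 hb
      rw [Berkovich.norm_crossRatio]
      exact hB.mul_div_lt_one hdist (fun i => (hβ i).1) (fun i => (hβ i).2) hne hγ hj hl δ η
    · intro h
      refine Berkovich.exists_isSchottkyFigure hg hdist (fun i => (hβ i).1) hne hγ
        fun i j l hj hl δ η => ?_
      rw [← Berkovich.norm_crossRatio]
      exact h i j l hj hl _ ((hpair j _).2 ⟨δ, rfl⟩) _ ((hpair l _).2 ⟨η, rfl⟩)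
  tfae_have 2 ↔ 3 := by
    refine forall_congr' fun i => ?_
    have hnonempty : (A \ {α i, α' i}).Nonempty := by
      have : Nontrivial (Fin g) := Fin.nontrivial_iff_two_le.2 hg
      obtain ⟨j, hj⟩ := exists_ne i
      exact ⟨α j, (hAi i _).2 ⟨j, hj, Or.inl rfl⟩⟩
    rw [Berkovich.exists_length_lt_iff (hne i) ((hA' _).2 ⟨i, Or.inl rfl⟩)
      ((hA' _).2 ⟨i, Or.inr rfl⟩) hfin hnonempty]
    constructor
    · intro h j l hj hl a ha b hb
      rw [Berkovich.norm_crossRatio, ← lt_inv_mul_iff₀ (hβ i).1, mul_one]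
      exact h a ((hAi i a).2 ⟨j, hj, ha⟩) b ((hAi i b).2 ⟨l, hl, hb⟩)
    · intro h a ha b hb
      obtain ⟨j, hj, ha⟩ := (hAi i a).1 ha
      obtain ⟨l, hl, hb⟩ := (hAi i b).1 hb
      have := h j l hj hl a ha b hb
      rwa [Berkovich.norm_crossRatio, ← lt_inv_mul_iff₀ (hβ i).1, mul_one] at this
  tfae_finish
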